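/- Let $E$ be a non-empty finite set. A rate matrix is $R\in\mathbb R^{E\times E}$ with $R_{ij}\ge 0$ for $i\ne j$ and $\sum_j R_{ij}=0$ for all $i$; let $\mathcal R$ be the set of all of them. **Environment and global evolution.** Let $G$ be a finite set of marks. Let $\Gamma$ be the set of sequences $\gamma=(g_n,t_n)_{n\in\mathbb Z}$ with $g_n\in G$, $t_n\in[-\infty,+\infty]$ non-decreasing, $t_0\le 0<t_1$, $t_n<t_{n+1}$ whenever $t_n$ is finite, and $t_n\to\pm\infty$ as $n\to\pm\infty$, with the $\sigma$-algebra generated by the coordinates $Y_n(\gamma)=g_n$, $T_n(\gamma)=t_n$. Let $\Omega=E\times\Gamma$, and let $\vartheta_t(i,(g_n,t_n)_n)=(i,(g_{n+m},t_{n+m}-t)_n)$ where $t_m\le t<t_{m+1}$. Given a bijection $\phi$ of $E\times G$ and $t\ge 0$, let $\psi_t$ be the bijection of $\Omega$ that leaves all times $t_n$ unchanged and, if $t_m\le t<t_{m+1}$, applies $\phi$ successively to the system state and the marks $g_1$, $g_2$, …, $g_m$, leaving the other marks unchanged. Put $\alpha_t=\vartheta_t\circ\psi_t$ for $t\ge 0$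 and $\alpha_t=\psi_{|t|}^{-1}\circ\vartheta_t$ for $t<0$. Let $X_0(i,\gamma)=i$, let $N_g(t)$ be the number of $n\ge1$ with $Y_n=g$ and $0<T_n\le t$, and let $\mathcal F_t=\sigma(X_0,N_g(s);\,g\in G,\,0\le s\le t)$. For a probability $q$ on $G$ and $\lambda>0$ let $q^{\otimes\mathbb Z}\otimes Q^\lambda_{\mathbb R}$ be the law on $\Gamma$ under which the marks $Y_n$ are i.i.d. with law $q$ and independent of $(T_n)_n$, which are the arrival times of a Poisson process on $\mathbb R$ with rate $\lambda$. **Poisson universal dilation.** $(G,\phi,(\mathbb Q_R)_{R\in\mathcal R})$ is called a Poisson universal dilation if, for every $R\in\mathcal R$: $\mathbb Q_R=q^{\otimes\mathbb Z}\otimes Q_{\mathbb R}^{\lambda}$ for some probability $q$ on $G$ and some $\lambda>0$; $(\vartheta_t)_{t\in\mathbb R}$ is a group; the maps $\psi_t$ are bimeasurable with $\psi_{t+s}=\vartheta_{-t}\circ\psi_s\circ\vartheta_t\circ\psi_t$ for $s,t\ge0$; $(\alpha_t)_{t\in\mathbb R}$ is a group of measurable maps with $\alpha_0=\mathrm{Id}$;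 and, with $\mathbb P_{k,R}=\delta_k\otimes\mathbb Q_R$, the process $X_t=X_0\circ\alpha_t$, $t\ge0$, is $\mathcal F_t$-adapted, starts from $k$ under $\mathbb P_{k,R}$, and satisfies $$\mathbb P_{k,R}(X_{t+s}=j\mid\mathcal F_t)=\mathbb P_{k,R}(X_{t+s}=j\mid X_t)=(e^{Rs})_{X_t\,j}\quad\text{a.s., for all } k,j\in E,\ s,t\ge 0 .$$ Thus $G$, $\phi$, $\Omega$, $\mathcal F_t$, $\alpha_t$ are the same for all $R$, and only $\mathbb Q_R$ depends on $R$. **Theorem 1.** For every non-empty finite set $E$ there is a Poisson universal dilation $(G,\phi,(\mathbb Q_R)_{R\in\mathcal R})$. More precisely, let $1\in E$ be any fixed element, $L$ the set of all maps $\beta:E\to E$, and $G=E\times L$. There are bijections $\phi$ of $E\times G$ such that $$\phi\big(i,(1,\beta)\big)=\big(\beta(i),(i,\beta)\big)\qquad\text{for all } i\in E,\ \beta\in L .$$ For any such $\phi$, $(G,\phi,(\mathbb Q_R)_{R\in\mathcal R})$ is a Poisson universal dilation, where $\mathbb Q_R=q^{\otimes\mathbb Z}\otimes Q^\lambda_{\mathbb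 R}$, $q=\delta_1\otimes p$, $p(\{\beta\})=\prod_{i\in E}P_{i\,\beta(i)}$, $P=I+\lambda^{-1}R$, and $\lambda=\max_{i}(-R_{ii})$ if $R\ne0$, $\lambda=1$ if $R=0$. -/

import Mathlib

open MeasureTheory ProbabilityTheory Filter
open scoped NNReal Topology

noncomputable section

/-! ### Rate matrices, Markov chains, dilations -/

/-- Transition rate matrices: nonnegative off-diagonal entries, rows summing to zero. -/
def IsRateMatrix {E : Type*} [Fintype E] (R : Matrix E E ℝ) : Prop :=
  (∀ i j, i ≠ j → 0 ≤ R i j) ∧ ∀ i, ∑ j, R i j = 0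

/-- The set of all transition rate matrices in `E`. -/
abbrev RateMatrix (E : Type*) [Fintype E] : Type _ := {R : Matrix E E ℝ // IsRateMatrix R}

/-- `(Ω, ℱ_t, X_t, (μ_k)_k)` is a homogeneous Markov chain in `E` with transition matrices
`exp (s R)`, started at `k` under `μ_k`. -/
structure IsMarkovChain {E Ω : Type*} [Fintype E] [DecidableEq E] [MeasurableSpace E]
    [mΩ : MeasurableSpace Ω] (R : Matrix E E ℝ) (ℱ : ℝ≥0 → MeasurableSpace Ω)
    (X : ℝ≥0 → Ω → E) (μ : E → Measure Ω) : Prop where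
  filtration_mono : Monotone ℱ
  filtration_le : ∀ t, ℱ t ≤ mΩ
  adapted : ∀ t, Measurable[ℱ t] (X t)
  isProbabilityMeasure : ∀ k, IsProbabilityMeasure (μ k)
  start : ∀ k, (μ k).map (X 0) = Measure.dirac k
  markov : ∀ (k j : E) (t s : ℝ≥0),
    (μ k)[(X (t + s) ⁻¹' {j}).indicator (fun _ => (1 : ℝ)) | ℱ t]
      =ᵐ[μ k] fun ω => NormedSpace.exp ((s : ℝ) • R) (X t ω) j
  markov_state : ∀ (k j : E) (t s : ℝ≥0),
    (μ k)[(X (t + s) ⁻¹' {j}).indicator (fun _ => (1 : ℝ)) |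
        MeasurableSpace.comap (X t) inferInstance]
      =ᵐ[μ k] fun ω => NormedSpace.exp ((s : ℝ) • R) (X t ω) j

/-- `(Ω, ℱ_t, Z_t, (μ_k)_k)` is a dilation of the semigroup `exp (t R)`, with environment state
space `Γ`, initial environment law `Q`, and group of global evolutions `α`. -/
structure IsDilation {E Γ Ω : Type*} [Fintype E] [DecidableEq E] [MeasurableSpace E]
    [MeasurableSpace Γ] [MeasurableSpace Ω] (R : Matrix E E ℝ) (ℱ : ℝ≥0 → MeasurableSpace Ω)
    (Z : ℝ≥0 → Ω → E × Γ) (α : ℝ → E × Γ → E × Γ) (Q : Measure Γ) (μ : E → Measure Ω) :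
    Prop where
  measurable : ∀ t, Measurable (Z t)
  markovChain : IsMarkovChain R ℱ (fun t ω => (Z t ω).1) μ
  isProbabilityMeasure : IsProbabilityMeasure Q
  initial : ∀ k, (μ k).map (Z 0) = (Measure.dirac k).prod Q
  evolution_zero : α 0 = id
  evolution_add : ∀ s t, α (s + t) = α s ∘ α t
  evolution_measurable : ∀ t, Measurable (α t)
  evolves : ∀ (t : ℝ≥0) (ω : Ω), Z t ω = α t (Z 0 ω)

/-- A universal dilation: the same `Ω`, `ℱ_t`, `Z_t`, `α_t` dilate the semigroups of all rate
matrices, and only the probabilities depend on the rate matrix. -/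
def IsUniversalDilation {E Γ Ω : Type*} [Fintype E] [DecidableEq E] [MeasurableSpace E]
    [MeasurableSpace Γ] [MeasurableSpace Ω] (ℱ : ℝ≥0 → MeasurableSpace Ω)
    (Z : ℝ≥0 → Ω → E × Γ) (α : ℝ → E × Γ → E × Γ) (Q : RateMatrix E → Measure Γ)
    (μ : RateMatrix E → E → Measure Ω) : Prop :=
  ∀ R : RateMatrix E, IsDilation R.1 ℱ Z α (Q R) (μ R)

/-! ### The canonical space of a marked simple point process on the line -/

/-- Bi-infinite sequences of arrival times of a simple (locally finite) point process on `ℝ`,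
numbered so that `t 0 ≤ 0 < t 1`; infinite times stand for absent points. -/
structure IsTimeSeq (t : ℤ → EReal) : Prop where
  mono : Monotone t
  simple : ∀ n, t n ≠ ⊥ → t n ≠ ⊤ → t n < t (n + 1)
  zero_le : t 0 ≤ 0
  one_pos : 0 < t 1
  tendsto_top : Tendsto t atTop (𝓝 ⊤)
  tendsto_bot : Tendsto t atBot (𝓝 ⊥)

/-- The canonical space of a simple point process on `ℝ`, with the σ-algebra generated by the
arrival times. -/
abbrev TimeSeq : Type := {t : ℤ → EReal // IsTimeSeq t}

/-- The canonical space of a simple point process on `ℝ` with marks in `G`, with the σ-algebra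
generated by the marks and the arrival times. -/
abbrev Env (G : Type*) : Type _ := (ℤ → G) × TimeSeq

theorem TimeSeq.existsUnique_index (τ : TimeSeq) (t : ℝ) :
    ∃! m : ℤ, τ.1 m ≤ t ∧ (t : EReal) < τ.1 (m + 1) := by
  have h1 : ∃ a, τ.1 a ≤ t :=
    ((τ.2.tendsto_bot.eventually (gt_mem_nhds (EReal.bot_lt_coe t))).exists).imp
      fun _ h => h.le
  obtain ⟨b, hb⟩ := (τ.2.tendsto_top.eventually (lt_mem_nhds (EReal.coe_lt_top t))).exists
  obtain ⟨m, hm, hmax⟩ := Int.exists_greatest_of_bdd (P := fun a => τ.1 a ≤ t)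
    ⟨b, fun z hz => by
      by_contra hlt
      exact absurd (hb.trans_le (τ.2.mono (not_le.1 hlt).le)) (not_lt.2 hz)⟩ h1
  refine ⟨m, ⟨hm, ?_⟩, ?_⟩
  · by_contra hlt
    have := hmax (m + 1) (not_lt.1 hlt)
    omega
  · rintro m' ⟨h, h'⟩
    refine le_antisymm (hmax m' h) ?_
    by_contra hlt
    have : m' + 1 ≤ m := by omega
    exact absurd (h'.trans_le (τ.2.mono this)) (not_lt.2 hm)

/-- The number `m` of the last arrival up to time `t`: `t_m ≤ t < t_{m+1}`. -/
def TimeSeq.index (τ : TimeSeq) (t : ℝ) : ℤ := (τ.existsUnique_index t).choose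

theorem TimeSeq.index_spec (τ : TimeSeq) (t : ℝ) :
    τ.1 (τ.index t) ≤ t ∧ (t : EReal) < τ.1 (τ.index t + 1) :=
  (τ.existsUnique_index t).choose_spec.1

/-- The left shift by `t` of a sequence of arrival times, renumbered. -/
def TimeSeq.shift (t : ℝ) (τ : TimeSeq) : TimeSeq :=
  ⟨fun n => τ.1 (n + τ.index t) - t, by
    have hs : StrictMono fun x : EReal => x - (t : EReal) := by
      intro x y hxy
      exact EReal.sub_lt_sub_of_lt_of_le hxy le_rfl (EReal.coe_ne_bot t) (EReal.coe_ne_top t)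
    have hc (a : EReal) (ha : a ≠ ⊥ ∨ a ≠ ⊤) :
        Tendsto (fun x : EReal => x - (t : EReal)) (𝓝 a) (𝓝 (a - t)) := by
      simp only [sub_eq_add_neg, ← EReal.coe_neg]
      exact (EReal.continuousAt_add (p := (a, ((-t : ℝ) : EReal))) (by simp) (by simp)).tendsto.comp
        (tendsto_id.prodMk_nhds tendsto_const_nhds)
    have hz : (t : EReal) - t = 0 := by
      rw [← EReal.coe_sub, sub_self, EReal.coe_zero]
    refine ⟨fun a b hab => hs.monotone (τ.2.mono (by omega)), fun n hb ht => ?_, ?_, ?_, ?_, ?_⟩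
    · have h := τ.2.simple (n + τ.index t) (fun h => hb (by simp [h]))
        (fun h => ht (by simp [h]))
      have := hs h
      simpa [add_right_comm] using this
    · simpa [hz] using hs.monotone (τ.index_spec t).1
    · simpa [hz, add_comm] using hs (τ.index_spec t).2
    · have := (hc ⊤ (by simp)).comp
        (τ.2.tendsto_top.comp (tendsto_atTop_add_const_right _ (τ.index t) tendsto_id))
      simpa [Function.comp_def] using this
    · have := (hc ⊥ (by simp)).comp
        (τ.2.tendsto_bot.comp (tendsto_atBot_add_const_right _ (τ.index t) tendsto_id))
      simpa [Function.comp_def] using this⟩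

/-! ### The global evolution -/

/-- The left shift `ϑ_t` of marks and arrival times, extended to `E × Env G` by the identity. -/
def shift {E G : Type*} (t : ℝ) (ω : E × Env G) : E × Env G :=
  (ω.1, fun n => ω.2.1 (n + ω.2.2.index t), ω.2.2.shift t)

/-- The coupling `φ` acting on the system and on the `n`-th mark. -/
def coupleAt {E G : Type*} (φ : Equiv.Perm (E × G)) (n : ℤ) : Equiv.Perm (E × (ℤ → G)) where
  toFun x := ((φ (x.1, x.2 n)).1, Function.update x.2 n (φ (x.1, x.2 n)).2)
  invFun x := ((φ.symm (x.1, x.2 n)).1, Function.update x.2 n (φ.symm (x.1, x.2 n)).2)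
  left_inv x := by simp
  right_inv x := by simp

/-- `φ_m ∘ ⋯ ∘ φ_1`: the system is coupled with the marks number `1, …, m`, in this order. -/
def coupleUpTo {E G : Type*} (φ : Equiv.Perm (E × G)) : ℕ → Equiv.Perm (E × (ℤ → G))
  | 0 => Equiv.refl _
  | m + 1 => (coupleUpTo φ m).trans (coupleAt φ (m + 1))

/-- The invertible map `ψ_t`, `t ≥ 0`: the system is coupled with the marks that arrive in
`(0, t]`; arrival times and other marks are unchanged. -/
def cocycle {E G : Type*} (φ : Equiv.Perm (E × G)) (t : ℝ≥0) : Equiv.Perm (E × Env G) where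
  toFun ω :=
    let r := coupleUpTo φ (ω.2.2.index t).toNat (ω.1, ω.2.1)
    (r.1, r.2, ω.2.2)
  invFun ω :=
    let r := (coupleUpTo φ (ω.2.2.index t).toNat).symm (ω.1, ω.2.1)
    (r.1, r.2, ω.2.2)
  left_inv ω := by simp
  right_inv ω := by simp

/-- The global evolution `α_t`: `ϑ_t ∘ ψ_t` for `t ≥ 0` and `ψ_{|t|}⁻¹ ∘ ϑ_t` for `t < 0`. -/
def evolution {E G : Type*} (φ : Equiv.Perm (E × G)) (t : ℝ) (ω : E × Env G) : E × Env G :=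
  if 0 ≤ t then shift t (cocycle φ t.toNNReal ω)
  else (cocycle φ (-t).toNNReal).symm (shift t ω)

/-- `N_g(t)`: the number of `n ≥ 1` with mark `g` and `0 < T_n ≤ t`. -/
def markCount {E G : Type*} (g : G) (t : ℝ≥0) (ω : E × Env G) : ℕ :=
  {n : ℤ | 1 ≤ n ∧ ω.2.1 n = g ∧ 0 < ω.2.2.1 n ∧ ω.2.2.1 n ≤ ((t : ℝ) : EReal)}.ncard

/-- `ℱ_t = σ(X_0, N_g(s); g ∈ G, 0 ≤ s ≤ t)`. -/
abbrev markFiltration (E G : Type*) [MeasurableSpace E] (t : ℝ≥0) : MeasurableSpace (E × Env G) :=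
  MeasurableSpace.comap (fun ω : E × Env G => ω.1) inferInstance ⊔
    ⨆ (g : G) (s : ℝ≥0) (_ : s ≤ t),
      MeasurableSpace.comap (fun ω : E × Env G => markCount g s ω) inferInstance

/-! ### The environment laws -/

/-- Arrival times with given gaps: `t_n = ξ_1 + ⋯ + ξ_n` for `n ≥ 1` and
`t_n = -(ξ_0 + ξ_{-1} + ⋯ + ξ_n)` for `n ≤ 0`. -/
def arrivalTimes (ξ : ℤ → ℝ) (n : ℤ) : EReal :=
  if 1 ≤ n then ((∑ k ∈ Finset.Icc 1 n, ξ k : ℝ) : EReal)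
  else ((-∑ k ∈ Finset.Icc n 0, ξ k : ℝ) : EReal)

/-- The law of the arrival times of a Poisson process on `ℝ` with rate `lam > 0`: the gaps
`t_1, t_2 - t_1, …` and `-t_0, t_0 - t_{-1}, …` are i.i.d. exponential. (The law on `ℤ → EReal`
is concentrated on `TimeSeq` and is restricted to it.) -/
def poissonLaw (lam : ℝ) : Measure TimeSeq :=
  ((Measure.infinitePi fun _ : ℤ => expMeasure lam).map arrivalTimes).comap Subtype.val

/-- `q^{⊗ℤ} ⊗ Q^lam`: i.i.d. marks with law `q`, independent of Poisson arrival times. -/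
def envLaw {G : Type*} [MeasurableSpace G] (q : Measure G) (lam : ℝ) : Measure (Env G) :=
  (Measure.infinitePi fun _ : ℤ => q).prod (poissonLaw lam)

/-! ### Poisson dilations -/

/-- `(G, φ, Q)` is a Poisson dilation of the semigroup `exp (t R)`. The sample space is
`E × Env G`, `Z_0` is the identity, `Z_t = α_t`, and `μ_k = δ_k ⊗ Q`. -/
structure IsPoissonDilation {E G : Type*} [Fintype E] [DecidableEq E] [MeasurableSpace E]
    [MeasurableSpace G] (φ : Equiv.Perm (E × G)) (Q : Measure (Env G)) (R : Matrix E E ℝ) :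
    Prop where
  mark_finite : Finite G
  law : ∃ (q : Measure G) (lam : ℝ), IsProbabilityMeasure q ∧ 0 < lam ∧ Q = envLaw q lam
  shift_add : ∀ s t : ℝ, (shift (s + t) : E × Env G → E × Env G) = shift s ∘ shift t
  cocycle_measurable : ∀ t, Measurable (cocycle φ t) ∧ Measurable (cocycle φ t).symm
  cocycle_add : ∀ (t s : ℝ≥0) (ω : E × Env G),
    cocycle φ (t + s) ω = shift (-t) (cocycle φ s (shift t (cocycle φ t ω)))
  dilation : IsDilation R (markFiltration E G) (fun t => evolution φ t) (evolution φ) Q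
    (fun k => (Measure.dirac k).prod Q)

/-- `(G, φ, (Q_R)_R)` is a Poisson universal dilation: a universal dilation given by Poisson
dilations with the same `G` and `φ` for all rate matrices `R`. -/
structure IsPoissonUniversalDilation {E G : Type*} [Fintype E] [DecidableEq E]
    [MeasurableSpace E] [MeasurableSpace G] (φ : Equiv.Perm (E × G))
    (Q : RateMatrix E → Measure (Env G)) : Prop where
  universal : IsUniversalDilation (markFiltration E G) (fun t : ℝ≥0 => evolution φ t)
    (evolution φ) Q (fun R k => (Measure.dirac k).prod (Q R))
  poisson : ∀ R : RateMatrix E, IsPoissonDilation φ (Q R) R.1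

/-! ### The mark space `E × L`, the coupling and the laws `Q_R` -/

/-- The mark space `G = E × L`, where `L` is the set of all maps `E → E`. -/
abbrev MapMark (E : Type*) : Type _ := E × (E → E)

/-- `φ (i, (e₀, β)) = (β i, (i, β))` for all states `i` and maps `β`. -/
def IsMapCoupling {E : Type*} (e₀ : E) (φ : Equiv.Perm (E × MapMark E)) : Prop :=
  ∀ (i : E) (β : E → E), φ (i, (e₀, β)) = (β i, (i, β))

/-- The rate `max_i (-R i i)`, or `1` if `R = 0`. -/
def jumpRate {E : Type*} [Fintype E] [Nonempty E] [DecidableEq E] (R : Matrix E E ℝ) : ℝ :=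
  if R = 0 then 1 else Finset.univ.sup' Finset.univ_nonempty fun i => -R i i

/-- The stochastic matrix `P = 1 + R / lam`, so that `R = lam (P - 1)`. -/
def jumpMatrix {E : Type*} [Fintype E] [Nonempty E] [DecidableEq E] (R : Matrix E E ℝ) :
    Matrix E E ℝ :=
  1 + (jumpRate R)⁻¹ • R

/-- The law `p` on maps `E → E`, with `p {β} = ∏ i, P i (β i)`. -/
def mapLaw {E : Type*} [Fintype E] [DecidableEq E] [MeasurableSpace E] (P : Matrix E E ℝ) :
    Measure (E → E) :=
  ∑ β : E → E, ENNReal.ofReal (∏ i, P i (β i)) • Measure.dirac β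

/-- `Q_R = q^{⊗ℤ} ⊗ Q^lam` with `q = δ_{e₀} ⊗ p`. -/
def rateEnvLaw {E : Type*} [Fintype E] [Nonempty E] [DecidableEq E] [MeasurableSpace E]
    (e₀ : E) (R : Matrix E E ℝ) : Measure (Env (MapMark E)) :=
  envLaw ((Measure.dirac e₀).prod (mapLaw (jumpMatrix R))) (jumpRate R)

end

open MeasureTheory ProbabilityTheory Filter
open scoped NNReal Topology

noncomputable section

/-! ### Algebra of shifts and cocycles -/

namespace TimeSeq

/-! Under `rateEnvLaw e₀ R` almost surely every mark has first component `e₀`, so the coupling at an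
arrival reads the map β of the mark and moves the state i to β i. A coupling never touches marks
that are still to come. Hence the state at t + s is the state at t moved by the k maps that arrive
in (t, t + s] (`coupleUpTo_add_fst`). The values of a random map are independent, with the rows of P
as laws, so k i.i.d. maps move i to j with probability (P ^ k) i j, independently of earlier marks
(`lintegral_past_mul_composeMarks`). The count k is Poisson with mean λs and independent of the past
(`poissonLaw_past_inter_increment`). Since sR = λs(P - 1), summing e^{-λs} (λs)^k / k! P^k over k
gives e^{sR} (`IsRateMatrix.hasSum_exp`).

Two facts tie this to ℱ_t. The state is adapted, because the counts reveal the marks that have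
arrived (`measurable_evolution_fst_markFiltration`). Conversely, on the event of m arrivals up to t,
an event of ℱ_t depends only on the initial state and the first m marks and times
(`exists_pastData_of_measurableSet`).

The Poisson increment is computed by integrating out one gap at a time. The tail of the last gap
produces a factor e^{λS}, S being the preceding arrival time; this factor cancels the exponential
densities and leaves Lebesgue volumes of simplices.

The matrix R enters only the laws. The group property is algebraic: the cocycle identity gives
α_{s+t} = α_s α_t for s, t ≥ 0, and α_{-t} = α_t⁻¹ extends it to all of ℝ. -/

theorem index_eq_iff (τ : TimeSeq) (t : ℝ) (m : ℤ) :
    τ.index t = m ↔ τ.1 m ≤ t ∧ (t : EReal) < τ.1 (m + 1) :=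
  ⟨fun h => h ▸ τ.index_spec t, fun h => (τ.existsUnique_index t).unique (τ.index_spec t) h⟩

theorem le_index_iff (τ : TimeSeq) (t : ℝ) (m : ℤ) : m ≤ τ.index t ↔ τ.1 m ≤ t := by
  constructor
  · exact fun h => (τ.2.mono h).trans (τ.index_spec t).1
  · intro h
    by_contra hlt
    exact absurd ((τ.index_spec t).2.trans_le (τ.2.mono (by omega : τ.index t + 1 ≤ m)))
      (not_lt.2 h)

theorem index_mono (τ : TimeSeq) : Monotone τ.index := fun s t h =>
  (τ.le_index_iff t _).2 ((τ.index_spec s).1.trans (EReal.coe_le_coe_iff.2 h))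

@[simp]
theorem index_zero (τ : TimeSeq) : τ.index 0 = 0 :=
  (τ.index_eq_iff 0 0).2 ⟨τ.2.zero_le, by simpa using τ.2.one_pos⟩

theorem index_nonneg (τ : TimeSeq) (t : ℝ≥0) : 0 ≤ τ.index t := by
  simpa using τ.index_mono t.2

theorem shift_apply (τ : TimeSeq) (t : ℝ) (n : ℤ) :
    (τ.shift t).1 n = τ.1 (n + τ.index t) - t := rfl

theorem index_shift (τ : TimeSeq) (s t : ℝ) :
    (τ.shift t).index s = τ.index (s + t) - τ.index t := by
  have h := τ.index_spec (s + t)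
  rw [index_eq_iff, shift_apply, shift_apply]
  have e : τ.index (s + t) - τ.index t + 1 + τ.index t = τ.index (s + t) + 1 := by ring
  rw [sub_add_cancel, e]
  refine ⟨?_, ?_⟩
  · rw [EReal.sub_le_iff_le_add (by simp) (by simp), ← EReal.coe_add]
    exact h.1
  · rw [EReal.lt_sub_iff_add_lt (by simp) (by simp), ← EReal.coe_add]
    exact h.2

theorem shift_shift (τ : TimeSeq) (s t : ℝ) : (τ.shift t).shift s = τ.shift (s + t) := by
  ext n
  simp only [shift_apply, index_shift]
  have e : n + (τ.index (s + t) - τ.index t) + τ.index t = n + τ.index (s + t) := by ring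
  rw [e, EReal.coe_add]
  -- Infinite times absorb every real shift; only finite ones need real arithmetic.
  induction τ.1 (n + τ.index (s + t)) using EReal.rec with
  | bot => simp
  | top => simp [← EReal.coe_add]
  | coe x => norm_cast; ring

theorem shift_zero (τ : TimeSeq) : τ.shift 0 = τ := by
  ext n
  simp [shift_apply]

end TimeSeq

/-! ### The cocycle identity and the group law of the evolution. -/

section Evolution

variable {E G : Type*}

theorem shift_add (s t : ℝ) : (shift (s + t) : E × Env G → E × Env G) = shift s ∘ shift t := by
  funext ω
  simp only [shift, Function.comp_apply, TimeSeq.shift_shift, TimeSeq.index_shift]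
  refine Prod.ext rfl (Prod.ext ?_ rfl)
  funext n
  exact congrArg ω.2.1 (by ring)

theorem shift_zero : (shift 0 : E × Env G → E × Env G) = id := by
  funext ω
  simp [shift, TimeSeq.shift_zero]

/-- The shift as a permutation. -/
def shiftPerm (t : ℝ) : Equiv.Perm (E × Env G) where
  toFun := shift t
  invFun := shift (-t)
  left_inv ω := by
    change (shift (-t) ∘ shift t) ω = ω
    rw [← shift_add, neg_add_cancel, shift_zero, id]
  right_inv ω := by
    change (shift t ∘ shift (-t)) ω = ω
    rw [← shift_add, add_neg_cancel, shift_zero, id]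

theorem shiftPerm_add (s t : ℝ) :
    (shiftPerm (s + t) : Equiv.Perm (E × Env G)) = shiftPerm s * shiftPerm t :=
  Equiv.ext fun ω => congrFun (shift_add s t) ω

theorem shiftPerm_neg (t : ℝ) :
    (shiftPerm (-t) : Equiv.Perm (E × Env G)) = (shiftPerm t)⁻¹ :=
  Equiv.ext fun _ => rfl

variable (φ : Equiv.Perm (E × G))

theorem coupleUpTo_succ (m : ℕ) (x : E × (ℤ → G)) :
    coupleUpTo φ (m + 1) x = coupleAt φ (m + 1) (coupleUpTo φ m x) := rfl

theorem coupleAt_fst (n : ℤ) (x : E × (ℤ → G)) :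
    (coupleAt φ n x).1 = (φ (x.1, x.2 n)).1 := rfl

theorem coupleAt_snd (n : ℤ) (x : E × (ℤ → G)) :
    (coupleAt φ n x).2 = Function.update x.2 n (φ (x.1, x.2 n)).2 := rfl

/-- Each coupling rewrites only its own mark, so mark m + 1 is still in its initial state when the
system meets it. -/
theorem coupleUpTo_snd_of_notMem (m : ℕ) (x : E × (ℤ → G)) (n : ℤ) (hn : n < 1 ∨ m < n) :
    (coupleUpTo φ m x).2 n = x.2 n := by
  induction m with
  | zero => rfl
  | succ m ih =>
    rw [coupleUpTo_succ, coupleAt_snd, Function.update_of_ne (by omega), ih (by omega)]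

/-- Coupling with the marks `m + 1, …, m + k` is coupling with `k` translated marks. -/
theorem coupleUpTo_add (m k : ℕ) (x : E × (ℤ → G)) :
    coupleUpTo φ (m + k) x =
      Prod.map id (fun y n => y (n - m))
        (coupleUpTo φ k (Prod.map id (fun y n => y (n + m)) (coupleUpTo φ m x))) := by
  induction k with
  | zero => simp [coupleUpTo, Prod.map]
  | succ k ih =>
    rw [← add_assoc, coupleUpTo_succ, ih, coupleUpTo_succ]
    generalize coupleUpTo φ k _ = z
    have e : ((m + k : ℕ) : ℤ) + 1 - m = k + 1 := by push_cast; ring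
    refine Prod.ext ?_ ?_
    · simp only [coupleAt_fst, Prod.map, e, id]
    · simp only [coupleAt_snd, Prod.map, e, id]
      funext n
      simp only [Function.update_apply]
      congr 1
      exact propext (by push_cast; omega)

theorem cocycle_apply (t : ℝ≥0) (ω : E × Env G) :
    cocycle φ t ω = ((coupleUpTo φ (ω.2.2.index t).toNat (ω.1, ω.2.1)).1,
      (coupleUpTo φ (ω.2.2.index t).toNat (ω.1, ω.2.1)).2, ω.2.2) := rfl

/-- With m arrivals up to t and k more up to t + s, the shift by t renumbers mark n + m as n. The
second cocycle therefore couples the original marks m + 1, …, m + k, and the shift by -t restores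
the numbering. -/
theorem cocycle_add (t s : ℝ≥0) (ω : E × Env G) :
    cocycle φ (t + s) ω = shift (-t) (cocycle φ s (shift t (cocycle φ t ω))) := by
  obtain ⟨i, y, τ⟩ := ω
  have h0 := τ.index_nonneg t
  have h1 : τ.index t ≤ τ.index (s + t) := τ.index_mono (by simp)
  obtain ⟨m, hm⟩ := Int.eq_ofNat_of_zero_le h0
  obtain ⟨k, hk⟩ := Int.eq_ofNat_of_zero_le (sub_nonneg.2 h1)
  have hmk : τ.index (t + s) = m + k := by rw [add_comm (t : ℝ)]; omega
  have e : (m + k : ℤ).toNat = m + k := by omega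
  -- The left side is the index of the shifted sequence at -t, by which the final shift renumbers.
  have e' : τ.index (-t + t) - τ.index t = -(m : ℤ) := by simp [hm]
  simp only [cocycle_apply, NNReal.coe_add, hmk, e, coupleUpTo_add]
  rw [hm] at hk
  simp only [shift, TimeSeq.index_shift, hm, hk, Int.toNat_natCast, TimeSeq.shift_shift,
    neg_add_cancel, TimeSeq.shift_zero]
  simp [Prod.map, sub_eq_add_neg]

/-- The global evolution as a permutation. -/
def evolutionPerm (t : ℝ) : Equiv.Perm (E × Env G) :=
  if 0 ≤ t then shiftPerm t * cocycle φ t.toNNReal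
  else (cocycle φ (-t).toNNReal)⁻¹ * shiftPerm t

theorem coe_evolutionPerm (t : ℝ) : ⇑(evolutionPerm φ t) = evolution φ t := by
  funext ω
  unfold evolutionPerm evolution
  split_ifs <;> rfl

theorem cocycle_zero : cocycle φ 0 = 1 := by
  ext ω : 1
  simp [cocycle_apply, coupleUpTo]

/-- For t > 0 the inverse of ϑ_t ψ_t is ψ_t⁻¹ ϑ_{-t}, which is the definition of α_{-t}. -/
theorem evolutionPerm_neg (t : ℝ) : evolutionPerm φ (-t) = (evolutionPerm φ t)⁻¹ := by
  have key (t : ℝ) (ht : 0 < t) : evolutionPerm φ (-t) = (evolutionPerm φ t)⁻¹ := by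
    rw [evolutionPerm, if_neg (by linarith), evolutionPerm, if_pos ht.le, neg_neg, mul_inv_rev,
      shiftPerm_neg]
  rcases lt_trichotomy t 0 with h | rfl | h
  · rw [eq_comm, inv_eq_iff_eq_inv, ← key (-t) (by linarith), neg_neg]
  · have : (shiftPerm 0 : Equiv.Perm (E × Env G)) = 1 := Equiv.ext fun ω => congrFun shift_zero ω
    simp [evolutionPerm, cocycle_zero, this]
  · exact key t h

/-- By the cocycle identity, ϑ_{s+t} ψ_{t+s} = ϑ_s ϑ_t (ϑ_t⁻¹ ψ_s ϑ_t ψ_t) = (ϑ_s ψ_s)(ϑ_t ψ_t). -/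
theorem evolutionPerm_add_of_nonneg {s t : ℝ} (hs : 0 ≤ s) (ht : 0 ≤ t) :
    evolutionPerm φ (s + t) = evolutionPerm φ s * evolutionPerm φ t := by
  have h : cocycle φ (t.toNNReal + s.toNNReal)
      = (shiftPerm t)⁻¹ * cocycle φ s.toNNReal * shiftPerm t * cocycle φ t.toNNReal := by
    rw [← shiftPerm_neg]
    ext ω : 1
    have := cocycle_add φ t.toNNReal s.toNNReal ω
    rwa [Real.coe_toNNReal t ht] at this
  rw [evolutionPerm, if_pos (by positivity), evolutionPerm, if_pos hs, evolutionPerm, if_pos ht,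
    add_comm s t, Real.toNNReal_add ht hs, h, add_comm t s, shiftPerm_add]
  group

/-- A map from `ℝ` to a group that is odd and additive on nonnegative reals is additive. -/
theorem map_add_of_nonneg_of_neg {H : Type*} [Group H] (f : ℝ → H) (hneg : ∀ t, f (-t) = (f t)⁻¹)
    (hadd : ∀ s t, 0 ≤ s → 0 ≤ t → f (s + t) = f s * f t) (s t : ℝ) : f (s + t) = f s * f t := by
  have hsub (a b : ℝ) (hb : 0 ≤ b) (hab : b ≤ a) : f (a - b) = f a * (f b)⁻¹ := by
    rw [eq_mul_inv_iff_mul_eq, ← hadd _ _ (by linarith) hb, sub_add_cancel]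
  have hsub' (a b : ℝ) (ha : 0 ≤ a) (hb : 0 ≤ b) : f (a - b) = f a * (f b)⁻¹ := by
    rcases le_total b a with h | h
    · exact hsub a b hb h
    · rw [← neg_sub, hneg, hsub b a ha h]
      simp
  have hsub'' (a b : ℝ) (ha : 0 ≤ a) (hb : 0 ≤ b) : f (-b + a) = (f b)⁻¹ * f a := by
    rcases le_total b a with h | h
    · rw [eq_inv_mul_iff_mul_eq, ← hadd _ _ hb (by linarith)]
      congr 1
      ring
    · have := hadd a (b - a) ha (by linarith)
      rw [add_sub_cancel] at this
      rw [this, show -b + a = -(b - a) by ring, hneg]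
      group
  rcases le_total 0 s with hs | hs <;> rcases le_total 0 t with ht | ht
  · exact hadd s t hs ht
  · have := hsub' s (-t) hs (by linarith)
    simpa [hneg] using this
  · have := hsub'' t (-s) ht (by linarith)
    simpa [hneg] using this
  · have := hadd (-t) (-s) (by linarith) (by linarith)
    rw [← neg_add_rev, hneg, hneg, hneg, ← mul_inv_rev, inv_inj] at this
    exact this

theorem evolution_add (s t : ℝ) : evolution φ (s + t) = evolution φ s ∘ evolution φ t := by
  simp only [← coe_evolutionPerm]
  rw [map_add_of_nonneg_of_neg (evolutionPerm φ) (evolutionPerm_neg φ)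
    (fun s t hs ht => evolutionPerm_add_of_nonneg φ hs ht), Equiv.Perm.coe_mul]

theorem evolution_coe (t : ℝ≥0) : evolution φ t = shift t ∘ cocycle φ t := by
  funext ω
  simp [evolution]

theorem evolution_zero : evolution φ 0 = id := by
  simpa [shift_zero, cocycle_zero] using evolution_coe φ 0

theorem evolution_fst (t : ℝ≥0) (ω : E × Env G) :
    (evolution φ t ω).1 = (coupleUpTo φ (ω.2.2.index t).toNat (ω.1, ω.2.1)).1 := by
  rw [evolution_coe]; rfl

end Evolution

/-! ### Measurability -/

section Measurability

theorem TimeSeq.measurable_time (n : ℤ) : Measurable fun τ : TimeSeq => τ.1 n :=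
  (measurable_pi_apply n).comp measurable_subtype_coe

theorem TimeSeq.measurable_index (t : ℝ) : Measurable fun τ : TimeSeq => τ.index t := by
  refine measurable_to_countable' fun m => ?_
  have : (fun τ : TimeSeq => τ.index t) ⁻¹' {m} =
      {τ | τ.1 m ≤ (t : EReal)} ∩ {τ | (t : EReal) < τ.1 (m + 1)} := by
    ext τ
    simp [TimeSeq.index_eq_iff]
  rw [this]
  exact (measurableSet_le (measurable_time m) measurable_const).inter
    (measurableSet_lt measurable_const (measurable_time (m + 1)))

/-- A function is measurable if it is so on each level set of a measurable discrete variable. -/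
theorem measurable_of_countable_param {α β ι : Type*} [MeasurableSpace α] [MeasurableSpace β]
    [MeasurableSpace ι] [Countable ι] [MeasurableSingletonClass ι] {N : α → ι} (hN : Measurable N)
    {f : ι → α → β} (hf : ∀ i, Measurable (f i)) : Measurable fun a => f (N a) a :=
  (measurable_from_prod_countable_left (f := fun p : α × ι => f p.2 p.1) hf).comp
    (measurable_id.prodMk hN)

theorem TimeSeq.measurable_shift (t : ℝ) : Measurable (TimeSeq.shift t) := by
  refine Measurable.subtype_mk (measurable_pi_lambda _ fun n => ?_)
  have h : Measurable fun τ : TimeSeq => τ.1 (n + τ.index t) :=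
    measurable_of_countable_param (measurable_index t) (f := fun m τ => τ.1 (n + m))
      fun m => measurable_time _
  exact h.sub_const _

variable {E G : Type*} [MeasurableSpace E] [MeasurableSpace G]

theorem measurable_index_env (t : ℝ) : Measurable fun ω : E × Env G => ω.2.2.index t :=
  (TimeSeq.measurable_index t).comp (measurable_snd.comp measurable_snd)

theorem measurable_time_env (n : ℤ) : Measurable fun ω : E × Env G => ω.2.2.1 n :=
  (TimeSeq.measurable_time n).comp (measurable_snd.comp measurable_snd)

theorem measurable_mark (n : ℤ) : Measurable fun ω : E × Env G => ω.2.1 n :=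
  (measurable_pi_apply n).comp (measurable_fst.comp measurable_snd)

theorem measurable_shift (t : ℝ) : Measurable (shift t : E × Env G → E × Env G) := by
  refine measurable_fst.prodMk (Measurable.prodMk (measurable_pi_lambda _ fun n => ?_)
    ((TimeSeq.measurable_shift t).comp (measurable_snd.comp measurable_snd)))
  exact measurable_of_countable_param (measurable_index_env t)
    (f := fun m (ω : E × Env G) => ω.2.1 (n + m)) fun m => measurable_mark _

variable (φ : Equiv.Perm (E × G))

/-- Stated for a plain map so as to serve both φ and its inverse. -/
theorem measurable_coupleAt_aux {f : E × G → E × G} (hf : Measurable f) (n : ℤ) :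
    Measurable fun x : E × (ℤ → G) =>
      ((f (x.1, x.2 n)).1, Function.update x.2 n (f (x.1, x.2 n)).2) := by
  have h : Measurable fun x : E × (ℤ → G) => f (x.1, x.2 n) :=
    hf.comp (measurable_fst.prodMk ((measurable_pi_apply n).comp measurable_snd))
  refine h.fst.prodMk (measurable_pi_lambda _ fun m => ?_)
  by_cases hm : m = n
  · subst hm
    simpa using h.snd
  · simp only [Function.update_of_ne hm]
    exact (measurable_pi_apply m).comp measurable_snd

theorem measurable_coupleUpTo (hφ : Measurable φ) (m : ℕ) : Measurable (coupleUpTo φ m) := by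
  induction m with
  | zero => exact measurable_id
  | succ m ih => exact (measurable_coupleAt_aux hφ (m + 1)).comp ih

theorem measurable_coupleUpTo_symm (hφ : Measurable φ.symm) (m : ℕ) :
    Measurable (coupleUpTo φ m).symm := by
  induction m with
  | zero => exact measurable_id
  | succ m ih => exact ih.comp (measurable_coupleAt_aux hφ (m + 1))

/-- The cocycle keeps the arrival times, so it and its inverse use the same number of couplings;
both are instances of this form. -/
theorem measurable_apply_index {f : ℕ → E × (ℤ → G) → E × (ℤ → G)} (hf : ∀ m, Measurable (f m))
    (t : ℝ) : Measurable fun ω : E × Env G =>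
      ((f (ω.2.2.index t).toNat (ω.1, ω.2.1)).1, (f (ω.2.2.index t).toNat (ω.1, ω.2.1)).2,
        ω.2.2) := by
  have h : Measurable fun ω : E × Env G => f (ω.2.2.index t).toNat (ω.1, ω.2.1) :=
    measurable_of_countable_param
      ((Measurable.of_discrete (f := Int.toNat)).comp (measurable_index_env t))
      (f := fun m (ω : E × Env G) => f m (ω.1, ω.2.1))
      fun m => (hf m).comp (measurable_fst.prodMk (measurable_fst.comp measurable_snd))
  exact h.fst.prodMk (h.snd.prodMk (measurable_snd.comp measurable_snd))

theorem measurable_cocycle (hφ : Measurable φ) (t : ℝ≥0) : Measurable (cocycle φ t) :=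
  measurable_apply_index (measurable_coupleUpTo φ hφ) t

theorem measurable_cocycle_symm (hφ : Measurable φ.symm) (t : ℝ≥0) :
    Measurable (cocycle φ t).symm :=
  measurable_apply_index (measurable_coupleUpTo_symm φ hφ) t

theorem measurable_evolution (hφ : Measurable φ) (hφ' : Measurable φ.symm) (t : ℝ) :
    Measurable (evolution φ t) := by
  by_cases ht : 0 ≤ t
  · have : evolution φ t = shift t ∘ cocycle φ t.toNNReal := by
      funext ω; simp [evolution, ht]
    rw [this]
    exact (measurable_shift t).comp (measurable_cocycle φ hφ _)
  · have : evolution φ t = (cocycle φ (-t).toNNReal).symm ∘ shift t := by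
      funext ω; simp [evolution, ht]
    rw [this]
    exact (measurable_cocycle_symm φ hφ' _).comp (measurable_shift t)

end Measurability

/-! ### The filtration generated by the mark counts -/

section Filtration

variable {E G : Type*}

open Classical in
-- Positivity of the time is automatic for n ≥ 1, and the counted set is finite, so `ncard` is a
-- true count.
theorem markCount_eq_card (g : G) (t : ℝ≥0) (ω : E × Env G) :
    markCount g t ω = ((Finset.Icc 1 (ω.2.2.index t)).filter fun n => ω.2.1 n = g).card := by
  rw [markCount, ← Set.ncard_coe_finset]
  congr 1
  ext n
  simp only [Set.mem_ofPred_eq, Finset.coe_filter, Finset.mem_Icc, TimeSeq.le_index_iff]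
  constructor
  · rintro ⟨h1, h2, -, h3⟩
    exact ⟨⟨h1, h3⟩, h2⟩
  · rintro ⟨⟨h1, h3⟩, h2⟩
    exact ⟨h1, h2, ω.2.2.2.one_pos.trans_le (ω.2.2.2.mono h1), h3⟩

/-- Recovers the number of arrivals from the generators of ℱ_t. -/
theorem sum_markCount [Fintype G] (t : ℝ≥0) (ω : E × Env G) :
    ∑ g : G, markCount g t ω = (ω.2.2.index t).toNat := by
  classical
  simp_rw [markCount_eq_card]
  rw [← Finset.card_eq_sum_card_fiberwise (f := ω.2.1) fun _ _ =>
    Finset.mem_coe.2 (Finset.mem_univ _)]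
  simp

/-- Allows the marks that have not yet arrived to be replaced by arbitrary ones in the proof of
adaptedness. -/
theorem coupleUpTo_fst_congr (φ : Equiv.Perm (E × G)) (m : ℕ) (i : E) {y y' : ℤ → G}
    (h : ∀ n : ℤ, 1 ≤ n → n ≤ m → y n = y' n) :
    (coupleUpTo φ m (i, y)).1 = (coupleUpTo φ m (i, y')).1 := by
  induction m with
  | zero => rfl
  | succ m ih =>
    rw [coupleUpTo_succ, coupleUpTo_succ, coupleAt_fst, coupleAt_fst,
      ih fun n h1 h2 => h n h1 (by push_cast; omega),
      coupleUpTo_snd_of_notMem φ m _ _ (Or.inr (by omega)),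
      coupleUpTo_snd_of_notMem φ m _ _ (Or.inr (by omega))]
    simp only
    rw [h (m + 1) (by omega) (by push_cast; omega)]

/-- The mark `n` is `g` and arrives up to time `t` iff the counts at suitable times before `t`
say so. -/
theorem mark_eq_and_time_le_iff [Fintype G] (g : G) (t : ℝ≥0) (n : ℕ) (ω : E × Env G) :
    ω.2.1 (n + 1) = g ∧ ω.2.2.1 (n + 1) ≤ ((t : ℝ) : EReal) ↔
      ∃ p q : ℚ≥0, ∑ h : G, markCount h (min (p : ℝ≥0) t) ω = n ∧
        ∑ h : G, markCount h (min (q : ℝ≥0) t) ω = n + 1 ∧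
        markCount g (min (q : ℝ≥0) t) ω = markCount g (min (p : ℝ≥0) t) ω + 1 := by
  classical
  set τ := ω.2.2 with hτ
  have hcount (a b : ℝ≥0) (ha : τ.index a = n) (hb : τ.index b = n + 1) :
      markCount g b ω = markCount g a ω + if ω.2.1 (n + 1) = g then 1 else 0 := by
    rw [markCount_eq_card, markCount_eq_card, ← hτ, ha, hb,
      ← Finset.insert_Icc_right_eq_Icc_add_one (by omega : (1 : ℤ) ≤ n + 1), Finset.filter_insert]
    split_ifs with h
    · rw [Finset.card_insert_of_notMem (by simp)]
    · rfl
  simp only [sum_markCount, ← hτ]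
  constructor
  · rintro ⟨hg, hn⟩
    have h0 : 0 < τ.1 (n + 1) := τ.2.one_pos.trans_le (τ.2.mono (by omega))
    have hne : τ.1 (n + 1) ≠ ⊤ := fun h => by simp [h] at hn
    -- The maximum with 0 makes the rational p below nonnegative, since t_n ≤ 0 when n = 0.
    have h1 : max (τ.1 n) 0 < τ.1 (n + 1) := by
      refine max_lt ?_ h0
      by_cases hb : τ.1 n = ⊥
      · rw [hb]
        exact bot_le.trans_lt h0
      · exact τ.2.simple n hb fun h => hne (top_le_iff.1 (h ▸ τ.2.mono (by omega)))
    have h2 : τ.1 (n + 1) < τ.1 (n + 1 + 1) :=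
      τ.2.simple _ (fun h => by simp [h] at h0) hne
    -- The times p and q lie just before and just after arrival n + 1. Truncating q at t does not
    -- lose this arrival, as it happens by time t. Rationals keep the union countable.
    obtain ⟨p, hp1, hp2⟩ := EReal.exists_rat_btwn_of_lt h1
    obtain ⟨q, hq1, hq2⟩ := EReal.exists_rat_btwn_of_lt h2
    have hp0 : 0 ≤ p := by
      have := (le_max_right _ _).trans_lt hp1
      have : (0 : ℝ) < p := by exact_mod_cast this
      exact_mod_cast this.le
    have hq0 : 0 ≤ q := by
      have := h0.trans hq1
      have : (0 : ℝ) < q := by exact_mod_cast this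
      exact_mod_cast this.le
    lift p to ℚ≥0 using hp0
    lift q to ℚ≥0 using hq0
    have hpt : (p : ℝ≥0) ≤ t := by
      have : ((p : ℚ) : ℝ) < t := by exact_mod_cast hp2.trans_le hn
      exact_mod_cast this.le
    have ha : τ.index (min (p : ℝ≥0) t : ℝ≥0) = n := by
      rw [min_eq_left hpt, TimeSeq.index_eq_iff]
      exact ⟨by exact_mod_cast (le_max_left _ _).trans hp1.le, by exact_mod_cast hp2⟩
    have hb : τ.index (min (q : ℝ≥0) t : ℝ≥0) = n + 1 := by
      rw [TimeSeq.index_eq_iff]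
      refine ⟨?_, ?_⟩
      · rcases min_choice (q : ℝ≥0) t with h | h <;> rw [h]
        · exact_mod_cast hq1.le
        · exact hn
      · refine lt_of_le_of_lt ?_ hq2
        have : min (q : ℝ≥0) t ≤ q := min_le_left _ _
        have : ((min (q : ℝ≥0) t : ℝ≥0) : ℝ) ≤ ((q : ℚ) : ℝ) := by exact_mod_cast this
        exact_mod_cast this
    refine ⟨p, q, by rw [ha]; simp, by rw [hb]; omega, ?_⟩
    rw [hcount _ _ ha hb, if_pos hg]
  · rintro ⟨p, q, h1, h2, h3⟩
    have ha : τ.index (min (p : ℝ≥0) t : ℝ≥0) = n := by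
      have := τ.index_nonneg (min (p : ℝ≥0) t)
      omega
    have hb : τ.index (min (q : ℝ≥0) t : ℝ≥0) = n + 1 := by
      have := τ.index_nonneg (min (q : ℝ≥0) t)
      omega
    refine ⟨?_, ?_⟩
    · rw [hcount _ _ ha hb] at h3
      by_contra hne
      simp [hne] at h3
    · refine ((TimeSeq.index_eq_iff _ _ _).1 hb).1.trans ?_
      exact_mod_cast min_le_right _ _

variable [MeasurableSpace E]

theorem markFiltration_mono : Monotone (markFiltration E G) := by
  intro s t hst
  refine sup_le_sup le_rfl (iSup_mono fun g => iSup_mono fun r => ?_)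
  exact iSup_le fun hr => le_iSup_of_le (hr.trans hst) le_rfl

theorem measurable_state_markFiltration (t : ℝ≥0) :
    Measurable[markFiltration E G t] fun ω : E × Env G => ω.1 :=
  Measurable.of_comap_le le_sup_left

theorem measurable_markCount_markFiltration (g : G) {s t : ℝ≥0} (hst : s ≤ t) :
    Measurable[markFiltration E G t] fun ω : E × Env G => markCount g s ω :=
  Measurable.of_comap_le <| le_trans
    (le_iSup_of_le g (le_iSup₂ (f := fun (s : ℝ≥0) (_ : s ≤ t) => MeasurableSpace.comap
      (fun ω : E × Env G => markCount g s ω) inferInstance) s hst)) le_sup_right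

theorem measurable_index_markFiltration [Fintype G] {s t : ℝ≥0} (hst : s ≤ t) :
    Measurable[markFiltration E G t] fun ω : E × Env G => (ω.2.2.index s).toNat := by
  simp_rw [← sum_markCount]
  exact Finset.measurable_fun_sum _ fun g _ => measurable_markCount_markFiltration g hst

theorem measurableSet_mark_eq_and_time_le [Fintype G] (g : G) (t : ℝ≥0) (n : ℕ) :
    MeasurableSet[markFiltration E G t]
      {ω : E × Env G | ω.2.1 (n + 1) = g ∧ ω.2.2.1 (n + 1) ≤ ((t : ℝ) : EReal)} := by
  simp_rw [mark_eq_and_time_le_iff]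
  have hs (p : ℚ≥0) : Measurable[markFiltration E G t]
      fun ω : E × Env G => ∑ h : G, markCount h (min (p : ℝ≥0) t) ω :=
    Finset.measurable_fun_sum _ fun g _ => measurable_markCount_markFiltration g (min_le_right _ _)
  have hc (p : ℚ≥0) : Measurable[markFiltration E G t]
      fun ω : E × Env G => markCount g (min (p : ℝ≥0) t) ω :=
    measurable_markCount_markFiltration g (min_le_right _ _)
  let := markFiltration E G t
  simp only [Set.ofPred_exists]
  refine MeasurableSet.iUnion fun p => MeasurableSet.iUnion fun q => ?_
  exact (measurableSet_eq_fun (hs p) measurable_const).inter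
    ((measurableSet_eq_fun (hs q) measurable_const).inter
      (measurableSet_eq_fun (hc q) ((hc p).add_const 1)))

/-- The state reads only marks that have arrived by t. Masking all others by a constant gives an
ℱ_t-measurable mark sequence with the same state. -/
theorem measurable_evolution_fst_markFiltration [Finite G] [Nonempty G] [MeasurableSpace G]
    [DiscreteMeasurableSpace G] (φ : Equiv.Perm (E × G)) (hφ : Measurable φ) (t : ℝ≥0) :
    Measurable[markFiltration E G t] fun ω : E × Env G => (evolution φ t ω).1 := by
  classical
  have := Fintype.ofFinite G
  let g₀ : G := Classical.arbitrary G
  let y (ω : E × Env G) (n : ℤ) : G :=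
    if 1 ≤ n ∧ ω.2.2.1 n ≤ ((t : ℝ) : EReal) then ω.2.1 n else g₀
  have hy : Measurable[markFiltration E G t] y := by
    refine @measurable_pi_lambda _ _ _ (markFiltration E G t) _ _ fun n => ?_
    by_cases hn : 1 ≤ n
    · obtain ⟨k, rfl⟩ : ∃ k : ℕ, n = k + 1 := ⟨(n - 1).toNat, by omega⟩
      refine @measurable_to_countable' _ _ _ _ (markFiltration E G t) _ fun g => ?_
      have key := fun g : G => measurableSet_mark_eq_and_time_le (E := E) g t k
      have h2 : MeasurableSet[markFiltration E G t]
          (⋃ g : G, {ω : E × Env G | ω.2.1 (k + 1) = g ∧ ω.2.2.1 (k + 1) ≤ ((t : ℝ) : EReal)}) :=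
        MeasurableSet.iUnion key
      -- The masked mark also equals g when g is the default value and the arrival has not happened.
      have : (fun ω => y ω (k + 1)) ⁻¹' {g} =
          {ω : E × Env G | ω.2.1 (k + 1) = g ∧ ω.2.2.1 (k + 1) ≤ ((t : ℝ) : EReal)} ∪
          if g = g₀ then (⋃ g : G, {ω : E × Env G | ω.2.1 (k + 1) = g ∧
            ω.2.2.1 (k + 1) ≤ ((t : ℝ) : EReal)})ᶜ else ∅ := by
        ext ω
        by_cases h : ω.2.2.1 (k + 1) ≤ ((t : ℝ) : EReal) <;> by_cases hg : g = g₀ <;>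
          simp [y, h, hg, eq_comm]
      rw [this]
      refine MeasurableSet.union (key g) ?_
      split_ifs
      · exact h2.compl
      · exact @MeasurableSet.empty _ (markFiltration E G t)
    · simp only [y, hn, false_and, if_false]
      exact measurable_const
  have hxy : Measurable[markFiltration E G t] fun ω => (ω.1, y ω) :=
    @Measurable.prodMk _ (markFiltration E G t) E (ℤ → G) _ _ _ y
      (measurable_state_markFiltration t) hy
  have h := @measurable_of_countable_param (E × Env G) (E × (ℤ → G)) ℕ (markFiltration E G t)
    _ _ _ _ _ (measurable_index_markFiltration le_rfl)
    (fun m ω => coupleUpTo φ m (ω.1, y ω))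
    fun m => (measurable_coupleUpTo φ hφ m).comp hxy
  have h' := measurable_fst.comp h
  convert h' using 1
  funext ω
  rw [evolution_fst, Function.comp_apply]
  refine coupleUpTo_fst_congr φ _ _ fun n h1 h2 => ?_
  have h0 := ω.2.2.index_nonneg t
  have : n ≤ ω.2.2.index t := by omega
  simp only [y, h1, (TimeSeq.le_index_iff _ _ _).1 this, and_self, if_true]

variable [MeasurableSpace G]

theorem measurable_markCount [MeasurableSingletonClass G] (g : G) (t : ℝ≥0) :
    Measurable fun ω : E × Env G => markCount g t ω := by
  classical
  simp_rw [markCount_eq_card, Finset.card_filter]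
  refine measurable_of_countable_param (measurable_index_env (t : ℝ))
    (f := fun m (ω : E × Env G) => ∑ n ∈ Finset.Icc 1 m, if ω.2.1 n = g then 1 else 0) fun m => ?_
  exact Finset.measurable_fun_sum _ fun n _ => Measurable.ite
    (measurable_mark n (measurableSet_singleton g)) measurable_const measurable_const

theorem markFiltration_le [MeasurableSingletonClass G] (t : ℝ≥0) :
    markFiltration E G t ≤ (inferInstance : MeasurableSpace (E × Env G)) :=
  sup_le measurable_fst.comap_le
    (iSup_le fun g => iSup_le fun s => iSup_le fun _ => (measurable_markCount g s).comap_le)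

/-- The initial state together with the first `m` marks and arrival times. -/
def pastData (m : ℤ) (ω : E × Env G) :
    E × (Finset.Icc 1 m → G) × (Finset.Icc 1 m → EReal) :=
  (ω.1, fun n => ω.2.1 n, fun n => ω.2.2.1 n)

/-- On the event that `m` marks arrive up to time `t`, the events of `ℱ_t` are determined by the
initial state and the first `m` marks and arrival times. -/
theorem exists_pastData_of_measurableSet [MeasurableSingletonClass G] {t : ℝ≥0}
    {A : Set (E × Env G)} (hA : MeasurableSet[markFiltration E G t] A) (m : ℤ) :
    ∃ D, MeasurableSet D ∧
      A ∩ {ω | ω.2.2.index t = m} = pastData m ⁻¹' D ∩ {ω | ω.2.2.index t = m} := by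
  classical
  let ι : {ω : E × Env G | ω.2.2.index t = m} → E × Env G := Subtype.val
  -- Pulling back to the level set commutes with suprema, so it suffices to treat generators. There,
  -- the count of g up to s ≤ t is the number of n ≤ m with mark g and time at most s, a function of
  -- the past data.
  have hle : (markFiltration E G t).comap ι ≤
      MeasurableSpace.comap (pastData m ∘ ι) inferInstance := by
    rw [MeasurableSpace.comap_sup, MeasurableSpace.comap_comp]
    simp only [MeasurableSpace.comap_iSup, MeasurableSpace.comap_comp]
    refine sup_le ?_ (iSup_le fun g => iSup_le fun s => iSup_le fun hs => ?_)
    · have h : Measurable[MeasurableSpace.comap (pastData m ∘ ι) inferInstance]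
          (Prod.fst ∘ (pastData m ∘ ι)) := measurable_fst.comp (comap_measurable _)
      exact h.comap_le
    · have hF : Measurable fun x : E × (Finset.Icc 1 m → G) × (Finset.Icc 1 m → EReal) =>
          ∑ n : Finset.Icc 1 m, if x.2.1 n = g ∧ x.2.2 n ≤ ((s : ℝ) : EReal) then 1 else 0 := by
        refine Finset.measurable_fun_sum _ fun n _ => Measurable.ite (MeasurableSet.inter ?_ ?_)
          measurable_const measurable_const
        · have h : Measurable fun x : E × (Finset.Icc 1 m → G) × (Finset.Icc 1 m → EReal) =>
              x.2.1 n := (measurable_pi_apply n).comp (measurable_fst.comp measurable_snd)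
          exact h (measurableSet_singleton g)
        · exact measurableSet_le ((measurable_pi_apply n).comp (measurable_snd.comp measurable_snd))
            measurable_const
      refine Measurable.comap_le ?_
      convert hF.comp (comap_measurable (pastData m ∘ ι)) using 1
      funext ω
      obtain ⟨ω, hω⟩ := ω
      have hω' : ω.2.2.index t = m := hω
      change markCount g s ω =
        ∑ n : Finset.Icc 1 m, if ω.2.1 n = g ∧ ω.2.2.1 n ≤ ((s : ℝ) : EReal) then 1 else 0
      rw [markCount_eq_card,
        Finset.sum_coe_sort (Finset.Icc 1 m)
          fun n => if ω.2.1 n = g ∧ ω.2.2.1 n ≤ ((s : ℝ) : EReal) then 1 else 0,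
        ← Finset.card_filter]
      congr 1
      ext n
      have : ω.2.2.index s ≤ m := hω' ▸ ω.2.2.index_mono (by exact_mod_cast hs)
      simp only [Finset.mem_filter, Finset.mem_Icc, ← TimeSeq.le_index_iff]
      constructor
      · rintro ⟨⟨h1, h2⟩, h3⟩
        exact ⟨⟨h1, h2.trans this⟩, h3, h2⟩
      · rintro ⟨⟨h1, h2⟩, h3, h4⟩
        exact ⟨⟨h1, h4⟩, h3⟩
  obtain ⟨D, hD, hDA⟩ := hle _ ⟨A, hA, rfl⟩
  refine ⟨D, hD, ?_⟩
  ext ω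
  simp only [Set.mem_inter_iff, Set.mem_preimage, Set.mem_ofPred_eq, and_congr_left_iff]
  intro hω
  have := Set.ext_iff.1 hDA ⟨ω, hω⟩
  exact this.symm

end Filtration

/-! ### The law of the arrival times -/

/-! ### The exponential law of a gap. -/

section Exponential

theorem lintegral_expMeasure {lam : ℝ} (F : ℝ → ENNReal) :
    ∫⁻ u, F u ∂expMeasure lam =
      ∫⁻ u in Set.Ioi 0, ENNReal.ofReal (lam * Real.exp (-(lam * u))) * F u := by
  have h : expMeasure lam = volume.withDensity (exponentialPDF lam) := rfl
  have hm : Measurable (exponentialPDF lam) :=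
    (measurable_exponentialPDFReal lam).ennreal_ofReal
  rw [h, lintegral_withDensity_eq_lintegral_mul_non_measurable _ hm
    (Eventually.of_forall fun _ => ENNReal.ofReal_lt_top), setLIntegral_congr Ioi_ae_eq_Ici,
    ← lintegral_indicator measurableSet_Ici]
  congr 1
  funext u
  by_cases hu : 0 ≤ u
  · simp [Set.indicator, hu, exponentialPDF_of_nonneg hu]
  · simp [Set.indicator, hu, exponentialPDF_of_neg (not_le.1 hu)]

/-- The weight cancels the exponential density; this turns integrals over gaps into Lebesgue
volumes. -/
theorem lintegral_exp_mul_expMeasure {lam : ℝ} (hlam : 0 < lam) {F : ℝ → ENNReal} :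
    ∫⁻ u, F u * ENNReal.ofReal (Real.exp (lam * u)) ∂expMeasure lam =
      ENNReal.ofReal lam * ∫⁻ u in Set.Ioi 0, F u := by
  rw [lintegral_expMeasure, ← lintegral_const_mul' _ _ ENNReal.ofReal_ne_top]
  congr 1
  funext u
  rw [mul_comm (F u), ← mul_assoc, ← ENNReal.ofReal_mul (by positivity), mul_assoc, ← Real.exp_add,
    neg_add_cancel, Real.exp_zero, mul_one]

theorem expMeasure_Ioi {lam : ℝ} (hlam : 0 < lam) {r : ℝ} (hr : 0 ≤ r) :
    expMeasure lam (Set.Ioi r) = ENNReal.ofReal (Real.exp (-(lam * r))) := by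
  have := isProbabilityMeasure_expMeasure hlam
  have h := cdf_expMeasure_eq hlam r
  rw [if_pos hr, cdf_eq_real] at h
  rw [← ofReal_measureReal, ← Set.compl_Iic, probReal_compl_eq_one_sub measurableSet_Iic, h]
  congr 1
  ring

theorem expMeasure_Iic_zero {lam : ℝ} (hlam : 0 < lam) : expMeasure lam (Set.Iic 0) = 0 := by
  have := isProbabilityMeasure_expMeasure hlam
  rw [← prob_compl_eq_one_iff measurableSet_Iic, Set.compl_Iic, expMeasure_Ioi hlam le_rfl]
  simp

end Exponential

/-! ### Integrating out a single coordinate of a product measure. -/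

section Update

/-- Resampling one coordinate preserves a product measure. -/
theorem map_update_infinitePi {ι : Type*} {X : ι → Type*} [DecidableEq ι]
    [∀ i, MeasurableSpace (X i)] (μ : ∀ i, Measure (X i)) [∀ i, IsProbabilityMeasure (μ i)]
    (j : ι) :
    ((Measure.infinitePi μ).prod (μ j)).map (fun p => Function.update p.1 j p.2) =
      Measure.infinitePi μ := by
  have hm : Measurable fun p : (∀ i, X i) × X j => Function.update p.1 j p.2 :=
    measurable_update'.comp measurable_id
  refine Measure.eq_infinitePi _ fun s t ht => ?_
  rw [Measure.map_apply hm (MeasurableSet.pi s.countable_toSet fun i _ => ht i)]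
  have h : (fun p : (∀ i, X i) × X j => Function.update p.1 j p.2) ⁻¹' (Set.pi s t) =
      Set.pi (s.erase j : Finset ι) t ×ˢ (if j ∈ s then t j else Set.univ) := by
    ext ⟨x, u⟩
    simp only [Set.mem_preimage, Set.mem_pi, Set.mem_prod, Finset.mem_coe, Finset.mem_erase]
    constructor
    · intro h
      refine ⟨fun i hi => by simpa [hi.1] using h i hi.2, ?_⟩
      split_ifs with hj
      · simpa using h j hj
      · trivial
    · rintro ⟨h1, h2⟩ i hi
      by_cases hij : i = j
      · subst hij
        simpa [hi] using h2
      · simpa [hij] using h1 i ⟨hij, hi⟩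
  rw [h, Measure.prod_prod, Measure.infinitePi_pi _ fun i _ => ht i]
  split_ifs with hj
  · rw [Finset.prod_erase_mul _ _ hj]
  · rw [Finset.erase_eq_of_notMem hj, measure_univ, mul_one]

/-- Fubini for one coordinate with the others frozen. It is applied both to the gaps and to the
marks. -/
theorem lintegral_update_infinitePi {ι : Type*} {X : ι → Type*} [DecidableEq ι]
    [∀ i, MeasurableSpace (X i)] (μ : ∀ i, Measure (X i)) [∀ i, IsProbabilityMeasure (μ i)]
    (j : ι) {F : (∀ i, X i) → ENNReal} (hF : Measurable F) :
    ∫⁻ x, F x ∂Measure.infinitePi μ =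
      ∫⁻ x, ∫⁻ u, F (Function.update x j u) ∂μ j ∂Measure.infinitePi μ := by
  have hm : Measurable fun p : (∀ i, X i) × X j => Function.update p.1 j p.2 :=
    measurable_update'.comp measurable_id
  conv_lhs => rw [← map_update_infinitePi μ j, lintegral_map hF hm]
  exact lintegral_prod _ (hF.comp hm).aemeasurable

end Update

/-- The time of the `n`-th arrival after `0`, as a function of the gaps. -/
def partialSum (n : ℕ) (ξ : ℤ → ℝ) : ℝ := ∑ i ∈ Finset.range n, ξ (i + 1)

theorem partialSum_zero (ξ : ℤ → ℝ) : partialSum 0 ξ = 0 := rfl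

theorem partialSum_succ (n : ℕ) (ξ : ℤ → ℝ) :
    partialSum (n + 1) ξ = partialSum n ξ + ξ (n + 1) := Finset.sum_range_succ _ _

theorem partialSum_update (n : ℕ) (ξ : ℤ → ℝ) (j : ℤ) (u : ℝ) (h : n < j) :
    partialSum n (Function.update ξ j u) = partialSum n ξ := by
  refine Finset.sum_congr rfl fun i hi => ?_
  have := Finset.mem_range.1 hi
  rw [Function.update_of_ne (by omega)]

theorem partialSum_succ_update (n : ℕ) (ξ : ℤ → ℝ) (u : ℝ) :
    partialSum (n + 1) (Function.update ξ (n + 1) u) = partialSum n ξ + u := by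
  rw [partialSum_succ, partialSum_update _ _ _ _ (by omega), Function.update_self]

theorem measurable_partialSum (n : ℕ) : Measurable (partialSum n) :=
  Finset.measurable_fun_sum _ fun _ _ => measurable_pi_apply _

/-! ### From i.i.d. gaps to the law on time sequences. -/

section ArrivalTimes

theorem sum_Icc_one (ξ : ℤ → ℝ) (n : ℕ) : ∑ k ∈ Finset.Icc (1 : ℤ) n, ξ k = partialSum n ξ := by
  induction n with
  | zero => simp [partialSum_zero]
  | succ n ih =>
    rw [partialSum_succ, ← ih, Nat.cast_succ,
      ← Finset.insert_Icc_right_eq_Icc_add_one (by omega : (1 : ℤ) ≤ n + 1),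
      Finset.sum_insert (by simp), add_comm]

theorem sum_Icc_zero (ξ : ℤ → ℝ) (n : ℕ) :
    ∑ k ∈ Finset.Icc (-n : ℤ) 0, ξ k = ∑ i ∈ Finset.range (n + 1), ξ (-i) := by
  induction n with
  | zero => simp
  | succ n ih =>
    rw [Finset.sum_range_succ, ← ih, Nat.cast_succ]
    have : Finset.Icc (-(n + 1 : ℤ)) 0 = insert (-(n + 1 : ℤ)) (Finset.Icc (-n : ℤ) 0) := by
      ext k
      simp only [Finset.mem_insert, Finset.mem_Icc]
      omega
    rw [this, Finset.sum_insert (by simp), add_comm]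

theorem arrivalTimes_succ (ξ : ℤ → ℝ) (n : ℕ) :
    arrivalTimes ξ (n + 1) = (partialSum (n + 1) ξ : ℝ) := by
  rw [arrivalTimes, if_pos (by omega), ← sum_Icc_one]
  simp

theorem arrivalTimes_neg (ξ : ℤ → ℝ) (n : ℕ) :
    arrivalTimes ξ (-n) = ((-∑ i ∈ Finset.range (n + 1), ξ (-i) : ℝ) : EReal) := by
  rw [arrivalTimes, if_neg (by omega), sum_Icc_zero]

/-- Positive gaps give strict monotonicity; divergence of the sums on both half-lines gives the
limits ±∞. -/
theorem isTimeSeq_arrivalTimes {ξ : ℤ → ℝ} (hpos : ∀ n, 0 < ξ n)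
    (h1 : ¬ Summable fun i : ℕ => ξ (i + 1)) (h2 : ¬ Summable fun i : ℕ => ξ (-i)) :
    IsTimeSeq (arrivalTimes ξ) := by
  rw [not_summable_iff_tendsto_nat_atTop_of_nonneg fun _ => (hpos _).le] at h1 h2
  let a (n : ℤ) : ℝ := (arrivalTimes ξ n).toReal
  have ha (n : ℤ) : arrivalTimes ξ n = a n := by
    simp only [a, arrivalTimes]
    split_ifs <;> simp only [EReal.toReal_coe]
  have ha1 (n : ℕ) : a (n + 1) = partialSum (n + 1) ξ := by
    simp only [a, arrivalTimes_succ, EReal.toReal_coe]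
  have ha2 (n : ℕ) : a (-n) = -∑ i ∈ Finset.range (n + 1), ξ (-i) := by
    simp only [a, arrivalTimes_neg, EReal.toReal_coe]
  have ha0 : a 0 = -ξ 0 := by simpa using ha2 0
  have ha1' : a 1 = ξ 1 := by simpa [partialSum] using ha1 0
  have hmono : StrictMono a := by
    refine strictMono_int_of_lt_succ fun n => ?_
    rcases lt_trichotomy n 0 with h | rfl | h
    · obtain ⟨k, rfl⟩ : ∃ k : ℕ, n = -((k + 1 : ℕ) : ℤ) := ⟨(-n - 1).toNat, by omega⟩
      have e : -((k + 1 : ℕ) : ℤ) + 1 = -(k : ℤ) := by push_cast; ring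
      rw [e, ha2, ha2, Finset.sum_range_succ _ (k + 1)]
      linarith [hpos (-((k + 1 : ℕ) : ℤ))]
    -- The interval around the origin consists of two gaps, ξ 0 and ξ 1.
    · rw [zero_add, ha0, ha1']
      linarith [hpos 0, hpos 1]
    · obtain ⟨k, rfl⟩ : ∃ k : ℕ, n = k + 1 := ⟨(n - 1).toNat, by omega⟩
      have e := ha1 (k + 1)
      push_cast at e
      rw [e, ha1, partialSum_succ (k + 1) ξ]
      linarith [hpos ((k + 1 : ℕ) + 1)]
  have he : arrivalTimes ξ = fun n => (a n : EReal) := funext ha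
  rw [he]
  refine ⟨fun m n h => EReal.coe_le_coe_iff.2 (hmono.monotone h), fun n _ _ =>
    EReal.coe_lt_coe_iff.2 (hmono (by omega)), ?_, ?_, ?_, ?_⟩
  · rw [ha0]
    exact_mod_cast (neg_neg_of_pos (hpos 0)).le
  · rw [ha1']
    exact_mod_cast hpos 1
  · rw [EReal.tendsto_coe_nhds_top_iff]
    refine tendsto_atTop_atTop_of_monotone hmono.monotone fun b => ?_
    obtain ⟨n, hn⟩ := ((h1.comp (tendsto_add_atTop_nat 1)).eventually_ge_atTop b).exists
    exact ⟨n + 1, by rw [ha1]; exact hn⟩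
  · rw [EReal.tendsto_coe_nhds_bot_iff]
    refine tendsto_atBot_atBot_of_monotone hmono.monotone fun b => ?_
    obtain ⟨n, hn⟩ := ((h2.comp (tendsto_add_atTop_nat 1)).eventually_ge_atTop (-b)).exists
    exact ⟨-n, by rw [ha2]; simp only [Function.comp_apply] at hn; linarith⟩

theorem measurable_arrivalTimes : Measurable arrivalTimes := by
  refine measurable_pi_lambda _ fun n => ?_
  unfold arrivalTimes
  split_ifs
  · exact (Finset.measurable_fun_sum _ fun k _ => measurable_pi_apply k).coe_real_ereal
  · exact (Finset.measurable_fun_sum _ fun k _ => measurable_pi_apply k).fun_neg.coe_real_ereal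

/-- Makes `Subtype.val` a measurable embedding, so that the comap in `poissonLaw` is the restriction
to time sequences. -/
theorem measurableSet_isTimeSeq : MeasurableSet {t : ℤ → EReal | IsTimeSeq t} := by
  have h : {t : ℤ → EReal | IsTimeSeq t} =
      (⋂ m : ℤ, ⋂ n : ℤ, ⋂ (_ : m ≤ n), {t | t m ≤ t n}) ∩
      (⋂ n : ℤ, {t | t n = ⊥} ∪ {t | t n = ⊤} ∪ {t | t n < t (n + 1)}) ∩
      {t | t 0 ≤ 0} ∩ {t | 0 < t 1} ∩ {t | Tendsto (fun n => t n) atTop (𝓝 ⊤)} ∩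
      {t | Tendsto (fun n => t n) atBot (𝓝 ⊥)} := by
    ext t
    simp only [Set.mem_ofPred_eq, Set.mem_inter_iff, Set.mem_iInter, Set.mem_union]
    constructor
    · intro h
      exact ⟨⟨⟨⟨⟨fun m n hmn => h.mono hmn, fun n => by
        by_cases hb : t n = ⊥
        · simp [hb]
        · by_cases ht : t n = ⊤
          · simp [ht]
          · exact Or.inr (h.simple n hb ht)⟩, h.zero_le⟩, h.one_pos⟩, h.tendsto_top⟩, h.tendsto_bot⟩
    · rintro ⟨⟨⟨⟨⟨h1, h2⟩, h3⟩, h4⟩, h5⟩, h6⟩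
      exact ⟨fun m n => h1 m n, fun n hb ht => by simpa [hb, ht] using h2 n, h3, h4, h5, h6⟩
  have m (n : ℤ) : Measurable fun t : ℤ → EReal => t n := measurable_pi_apply n
  rw [h]
  refine ((((MeasurableSet.inter ?_ ?_).inter ?_).inter ?_).inter ?_).inter ?_
  · exact MeasurableSet.iInter fun i => MeasurableSet.iInter fun j => MeasurableSet.iInter fun _ =>
      measurableSet_le (m i) (m j)
  · exact MeasurableSet.iInter fun i => (((measurableSet_eq_fun (m i) measurable_const).union
      (measurableSet_eq_fun (m i) measurable_const)).union (measurableSet_lt (m i) (m (i + 1))))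
  · exact measurableSet_le (m 0) measurable_const
  · exact measurableSet_lt measurable_const (m 1)
  · exact measurableSet_tendsto _ m
  · exact measurableSet_tendsto _ m

/-- The law of the i.i.d. exponential gaps. -/
abbrev gapLaw (lam : ℝ) : Measure (ℤ → ℝ) := Measure.infinitePi fun _ : ℤ => expMeasure lam

theorem ae_gap_pos {lam : ℝ} (hlam : 0 < lam) : ∀ᵐ ξ ∂gapLaw lam, ∀ n, 0 < ξ n := by
  have := isProbabilityMeasure_expMeasure hlam
  refine ae_all_iff.2 fun n => ?_
  have h : ∀ᵐ u ∂expMeasure lam, 0 < u := by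
    rw [ae_iff]
    simpa [← Set.Iic_def] using expMeasure_Iic_zero hlam
  exact (measurePreserving_eval_infinitePi
    (fun _ : ℤ => expMeasure lam) n).quasiMeasurePreserving.ae h

/-- Second Borel–Cantelli lemma: the independent events that a gap exceeds 1 have the same positive
probability, so infinitely many occur and the gaps do not tend to 0. -/
theorem ae_not_summable_gap {lam : ℝ} (hlam : 0 < lam) {f : ℕ → ℤ} (hf : Function.Injective f) :
    ∀ᵐ ξ ∂gapLaw lam, ¬ Summable fun i => ξ (f i) := by
  have := isProbabilityMeasure_expMeasure hlam
  have hind : iIndepFun (fun (i : ℕ) (ξ : ℤ → ℝ) => ξ (f i)) (gapLaw lam) :=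
    (iIndepFun_infinitePi (X := fun (_ : ℤ) (x : ℝ) => x) fun _ => measurable_id).precomp hf
  let s (i : ℕ) : Set (ℤ → ℝ) := (fun ξ => ξ (f i)) ⁻¹' Set.Ioi 1
  have hs (i : ℕ) : MeasurableSet (s i) := measurable_pi_apply (f i) measurableSet_Ioi
  have hsi : iIndepSet s (gapLaw lam) := by
    rw [iIndepSet_iff_meas_biInter hs]
    intro t
    exact hind.meas_biInter fun i _ => ⟨_, measurableSet_Ioi, rfl⟩
  have hμ (i : ℕ) : gapLaw lam (s i) = ENNReal.ofReal (Real.exp (-(lam * 1))) := by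
    rw [← expMeasure_Ioi hlam zero_le_one]
    exact (measurePreserving_eval_infinitePi (fun _ : ℤ => expMeasure lam) (f i)).measure_preimage
      measurableSet_Ioi.nullMeasurableSet
  have h := measure_limsup_eq_one hs hsi (by
    simp_rw [hμ]
    exact ENNReal.tsum_const_eq_top_of_ne_zero (by simp [Real.exp_pos]))
  have h' : ∀ᵐ ξ ∂gapLaw lam, ξ ∈ limsup s atTop := by
    rw [← prob_compl_eq_zero_iff (MeasurableSet.measurableSet_limsup hs)] at h
    exact h
  filter_upwards [h'] with ξ hξ hsum
  rw [mem_limsup_iff_frequently_mem] at hξ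
  refine hξ ?_
  filter_upwards [hsum.tendsto_atTop_zero.eventually_lt_const zero_lt_one] with i hi hi'
  exact lt_asymm hi hi'

theorem ae_isTimeSeq {lam : ℝ} (hlam : 0 < lam) : ∀ᵐ ξ ∂gapLaw lam, IsTimeSeq (arrivalTimes ξ) := by
  filter_upwards [ae_gap_pos hlam,
    ae_not_summable_gap hlam (f := fun i => (i : ℤ) + 1) fun i j h => by simpa using h,
    ae_not_summable_gap hlam (f := fun i => -(i : ℤ)) fun i j h => by simpa using h]
    with ξ h1 h2 h3 using isTimeSeq_arrivalTimes h1 h2 h3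

/-- No mass is lost in the restriction, because the gaps almost surely produce a time sequence. -/
theorem map_val_poissonLaw {lam : ℝ} (hlam : 0 < lam) :
    (poissonLaw lam).map Subtype.val = (gapLaw lam).map arrivalTimes := by
  have h := (MeasurableEmbedding.subtype_coe measurableSet_isTimeSeq).map_comap
    ((gapLaw lam).map arrivalTimes)
  refine h.trans ?_
  rw [Subtype.range_coe]
  refine Measure.restrict_eq_self_of_ae_mem ?_
  exact (ae_map_iff measurable_arrivalTimes.aemeasurable measurableSet_isTimeSeq).2
    (ae_isTimeSeq hlam)

theorem poissonLaw_preimage {lam : ℝ} (hlam : 0 < lam) {B : Set (ℤ → EReal)}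
    (hB : MeasurableSet B) :
    poissonLaw lam (Subtype.val ⁻¹' B) = gapLaw lam (arrivalTimes ⁻¹' B) := by
  rw [← Measure.map_apply measurable_subtype_coe hB, map_val_poissonLaw hlam,
    Measure.map_apply measurable_arrivalTimes hB]

theorem isProbabilityMeasure_poissonLaw {lam : ℝ} (hlam : 0 < lam) :
    IsProbabilityMeasure (poissonLaw lam) := by
  have := isProbabilityMeasure_expMeasure hlam
  refine ⟨?_⟩
  simpa using poissonLaw_preimage hlam MeasurableSet.univ

end ArrivalTimes

/-! ### Independence of the past and Poisson law of the increments -/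

section PoissonIncrement

/-- The recursion for volumes of simplices. The positive part lets s be any real number, as the
induction that uses it replaces s by s - u for every u > 0. -/
theorem lintegral_Ioi_pow_max {lam : ℝ} (hlam : 0 < lam) (k : ℕ) (s : ℝ) :
    ENNReal.ofReal lam * ∫⁻ u in Set.Ioi 0,
        ENNReal.ofReal ((lam * max (s - u) 0) ^ (k + 1) / (k + 1).factorial) =
      ENNReal.ofReal ((lam * max s 0) ^ (k + 2) / (k + 2).factorial) := by
  rcases le_or_gt s 0 with hs | hs
  · have h : ∫⁻ u in Set.Ioi (0 : ℝ),
        ENNReal.ofReal ((lam * max (s - u) 0) ^ (k + 1) / (k + 1).factorial) = 0 := by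
      rw [← lintegral_zero (μ := volume.restrict (Set.Ioi (0 : ℝ)))]
      refine setLIntegral_congr_fun measurableSet_Ioi fun u hu => ?_
      have : s - u ≤ 0 := by linarith [Set.mem_Ioi.1 hu]
      simp [max_eq_right this]
    rw [h, max_eq_right hs]
    simp
  · have h : ∫⁻ u in Set.Ioi (0 : ℝ),
        ENNReal.ofReal ((lam * max (s - u) 0) ^ (k + 1) / (k + 1).factorial) =
        ∫⁻ u in Set.Ioc 0 s, ENNReal.ofReal ((lam * (s - u)) ^ (k + 1) / (k + 1).factorial) := by
      rw [← lintegral_indicator measurableSet_Ioi, ← lintegral_indicator measurableSet_Ioc]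
      congr 1
      funext u
      by_cases h0 : 0 < u
      · rcases le_or_gt u s with h1 | h1
        · simp [Set.indicator, h0, h1]
        · simp [Set.indicator, h0, h1.not_ge, max_eq_right (sub_neg.2 h1).le]
      · simp [Set.indicator, h0]
    have hcont : Continuous fun u : ℝ => (lam * (s - u)) ^ (k + 1) / (k + 1).factorial := by
      fun_prop
    rw [h, ← ofReal_integral_eq_lintegral_ofReal, ← ENNReal.ofReal_mul hlam.le,
      ← intervalIntegral.integral_of_le hs.le, max_eq_left hs.le]
    · congr 1
      simp_rw [mul_pow]
      rw [intervalIntegral.integral_div, intervalIntegral.integral_const_mul,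
        intervalIntegral.integral_comp_sub_left (fun x => x ^ (k + 1)), integral_pow]
      rw [Nat.factorial_succ (k + 1)]
      have : ((k + 1).factorial : ℝ) ≠ 0 := by positivity
      push_cast
      field_simp
      ring
    · exact hcont.integrableOn_Ioc
    · filter_upwards [ae_restrict_mem measurableSet_Ioc] with u hu
      have : 0 ≤ s - u := sub_nonneg.2 hu.2
      change (0 : ℝ) ≤ _
      positivity

variable {lam : ℝ}

/-- Gap n + 1 is resampled; neither V nor the partial sum up to n sees it. -/
theorem lintegral_mul_comp_partialSum_succ (hlam : 0 < lam) (n : ℕ) {V : (ℤ → ℝ) → ENNReal}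
    (hV : Measurable V) (hVu : ∀ ξ u, V (Function.update ξ (n + 1) u) = V ξ) {H : ℝ → ENNReal}
    (hH : Measurable H) :
    ∫⁻ ξ, V ξ * H (partialSum (n + 1) ξ) ∂gapLaw lam =
      ∫⁻ ξ, V ξ * ∫⁻ u, H (partialSum n ξ + u) ∂expMeasure lam ∂gapLaw lam := by
  have := isProbabilityMeasure_expMeasure hlam
  rw [lintegral_update_infinitePi (fun _ : ℤ => expMeasure lam) (n + 1)
    (F := fun ξ => V ξ * H (partialSum (n + 1) ξ)) (hV.mul (hH.comp (measurable_partialSum _)))]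
  congr 1
  funext ξ
  simp only [hVu, partialSum_succ_update]
  exact lintegral_const_mul _ (hH.comp (measurable_const_add _))

/-- The weight e^{λ(S + u)} splits: one factor stays on the partial sum S for the next step, the
other turns the law of the gap u into λ du. -/
theorem lintegral_mul_exp_partialSum_succ (hlam : 0 < lam) (n : ℕ) {V : (ℤ → ℝ) → ENNReal}
    (hV : Measurable V) (hVu : ∀ ξ u, V (Function.update ξ (n + 1) u) = V ξ) {H : ℝ → ENNReal}
    (hH : Measurable H) :
    ∫⁻ ξ, V ξ * (H (partialSum (n + 1) ξ) *
        ENNReal.ofReal (Real.exp (lam * partialSum (n + 1) ξ))) ∂gapLaw lam =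
      ENNReal.ofReal lam * ∫⁻ ξ, V ξ * ENNReal.ofReal (Real.exp (lam * partialSum n ξ)) *
        (∫⁻ u in Set.Ioi 0, H (partialSum n ξ + u)) ∂gapLaw lam := by
  rw [lintegral_mul_comp_partialSum_succ hlam n hV hVu
    (H := fun x => H x * ENNReal.ofReal (Real.exp (lam * x))) (by fun_prop),
    ← lintegral_const_mul' _ _ ENNReal.ofReal_ne_top]
  congr 1
  funext ξ
  have h (u : ℝ) : H (partialSum n ξ + u) *
      ENNReal.ofReal (Real.exp (lam * (partialSum n ξ + u))) =
      ENNReal.ofReal (Real.exp (lam * partialSum n ξ)) *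
        (H (partialSum n ξ + u) * ENNReal.ofReal (Real.exp (lam * u))) := by
    rw [mul_add, Real.exp_add, ENNReal.ofReal_mul (Real.exp_pos _).le]
    ring
  simp_rw [h]
  rw [lintegral_const_mul' _ _ ENNReal.ofReal_ne_top, lintegral_exp_mul_expMeasure hlam]
  ring

/-- Here W is a function of the past that vanishes unless arrival m occurs by t. Under the
exponential weight the k + 1 arrivals in (t, t + s] are distributed like Lebesgue measure times
λ^{k+1}, which gives the volume of an ordered simplex. -/
theorem lintegral_past_mul_arrivals (hlam : 0 < lam) {m : ℕ} {t : ℝ} {W : (ℤ → ℝ) → ENNReal}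
    (hW : Measurable W) (hWu : ∀ ξ (j : ℤ) u, m < j → W (Function.update ξ j u) = W ξ)
    (hW0 : ∀ ξ, t < partialSum m ξ → W ξ = 0) (k : ℕ) (s : ℝ) :
    ∫⁻ ξ, W ξ * (Set.Ioi t).indicator 1 (partialSum (m + 1) ξ) *
        ((Set.Iic (t + s)).indicator 1 (partialSum (m + k + 1) ξ) *
          ENNReal.ofReal (Real.exp (lam * partialSum (m + k + 1) ξ))) ∂gapLaw lam =
      (∫⁻ ξ, W ξ * ENNReal.ofReal (Real.exp (lam * partialSum m ξ)) ∂gapLaw lam) *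
        ENNReal.ofReal ((lam * max s 0) ^ (k + 1) / (k + 1).factorial) := by
  have := isProbabilityMeasure_expMeasure hlam
  have hexp (n : ℕ) : Measurable fun ξ : ℤ → ℝ =>
      ENNReal.ofReal (Real.exp (lam * partialSum n ξ)) :=
    (((measurable_partialSum n).const_mul lam).exp).ennreal_ofReal
  induction k generalizing s with
  | zero =>
    have hH : Measurable ((Set.Ioi t).indicator (1 : ℝ → ENNReal) *
        (Set.Iic (t + s)).indicator 1) :=
      (measurable_one.indicator measurableSet_Ioi).mul (measurable_one.indicator measurableSet_Iic)
    have h := lintegral_mul_exp_partialSum_succ hlam m hW (fun ξ u => hWu ξ _ u (by omega)) hH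
    simp only [Pi.mul_apply] at h
    simp_rw [mul_assoc] at h ⊢
    rw [add_zero, h, ← lintegral_mul_const' _ _ ENNReal.ofReal_ne_top,
      ← lintegral_const_mul' _ _ ENNReal.ofReal_ne_top]
    congr 1
    funext ξ
    rcases le_or_gt (partialSum m ξ) t with hle | hlt
    -- As arrival m is not after t, the admissible gaps form an interval of length s inside (0, ∞).
    · have : ∫⁻ u in Set.Ioi 0, (Set.Ioi t).indicator (1 : ℝ → ENNReal) (partialSum m ξ + u) *
          (Set.Iic (t + s)).indicator 1 (partialSum m ξ + u) = ENNReal.ofReal (max s 0) := by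
        rw [← lintegral_indicator measurableSet_Ioi]
        have he : ((Set.Ioi 0).indicator fun u : ℝ => (Set.Ioi t).indicator (1 : ℝ → ENNReal)
            (partialSum m ξ + u) * (Set.Iic (t + s)).indicator 1 (partialSum m ξ + u)) =
            (Set.Ioc (t - partialSum m ξ) (t - partialSum m ξ + s)).indicator 1 := by
          funext u
          simp only [Set.indicator, Set.mem_Ioi, Set.mem_Iic, Set.mem_Ioc, Pi.one_apply]
          by_cases h1 : t < partialSum m ξ + u <;> by_cases h2 : partialSum m ξ + u ≤ t + s
          · rw [if_pos (by linarith), if_pos h1, if_pos h2, if_pos ⟨by linarith, by linarith⟩,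
              one_mul]
          · rw [if_neg h2, mul_zero, ite_self, if_neg fun h => h2 (by linarith [h.2])]
          · rw [if_neg h1, zero_mul, ite_self, if_neg fun h => h1 (by linarith [h.1])]
          · rw [if_neg h1, zero_mul, ite_self, if_neg fun h => h1 (by linarith [h.1])]
        rw [he, lintegral_indicator_one measurableSet_Ioc, Real.volume_Ioc, add_sub_cancel_left]
        rcases le_total s 0 with hs | hs
        · rw [max_eq_right hs, ENNReal.ofReal_of_nonpos hs, ENNReal.ofReal_zero]
        · rw [max_eq_left hs]
      rw [this]
      simp only [zero_add, pow_one, Nat.factorial_one, Nat.cast_one, div_one]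
      rw [ENNReal.ofReal_mul hlam.le]
      ring
    · simp [hW0 ξ hlt]
  | succ k ih =>
    have hV : Measurable fun ξ => W ξ * (Set.Ioi t).indicator 1 (partialSum (m + 1) ξ) :=
      hW.mul ((measurable_one.indicator measurableSet_Ioi).comp (measurable_partialSum _))
    have hH : Measurable ((Set.Iic (t + s)).indicator (1 : ℝ → ENNReal)) :=
      measurable_one.indicator measurableSet_Iic
    have h := lintegral_mul_exp_partialSum_succ hlam (m + k + 1) hV (fun ξ u => by
      rw [hWu ξ _ u (by push_cast; omega), partialSum_update _ _ _ _ (by push_cast; omega)]) hH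
    rw [← add_assoc, h]
    -- With the last gap u integrated outermost, the remaining arrivals must end by t + (s - u),
    -- which is the induction hypothesis at s - u.
    have hsw : ∫⁻ ξ, W ξ * (Set.Ioi t).indicator 1 (partialSum (m + 1) ξ) *
        ENNReal.ofReal (Real.exp (lam * partialSum (m + k + 1) ξ)) *
        (∫⁻ u in Set.Ioi 0, (Set.Iic (t + s)).indicator 1 (partialSum (m + k + 1) ξ + u))
          ∂gapLaw lam =
        ∫⁻ u in Set.Ioi 0, ∫⁻ ξ, W ξ * (Set.Ioi t).indicator 1 (partialSum (m + 1) ξ) *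
          ((Set.Iic (t + (s - u))).indicator 1 (partialSum (m + k + 1) ξ) *
          ENNReal.ofReal (Real.exp (lam * partialSum (m + k + 1) ξ))) ∂gapLaw lam := by
      have hmeas : Measurable fun p : (ℤ → ℝ) × ℝ =>
          W p.1 * (Set.Ioi t).indicator 1 (partialSum (m + 1) p.1) *
          ENNReal.ofReal (Real.exp (lam * partialSum (m + k + 1) p.1)) *
          (Set.Iic (t + s)).indicator 1 (partialSum (m + k + 1) p.1 + p.2) :=
        ((hV.mul (hexp _)).comp measurable_fst).mul
          (hH.comp (((measurable_partialSum _).comp measurable_fst).add measurable_snd))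
      have h1 (ξ : ℤ → ℝ) : W ξ * (Set.Ioi t).indicator 1 (partialSum (m + 1) ξ) *
          ENNReal.ofReal (Real.exp (lam * partialSum (m + k + 1) ξ)) *
          ∫⁻ u in Set.Ioi 0, (Set.Iic (t + s)).indicator 1 (partialSum (m + k + 1) ξ + u) =
          ∫⁻ u in Set.Ioi 0, W ξ * (Set.Ioi t).indicator 1 (partialSum (m + 1) ξ) *
          ENNReal.ofReal (Real.exp (lam * partialSum (m + k + 1) ξ)) *
          (Set.Iic (t + s)).indicator 1 (partialSum (m + k + 1) ξ + u) :=
        (lintegral_const_mul _ (hH.comp (measurable_const_add _))).symm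
      simp_rw [h1]
      rw [lintegral_lintegral_swap hmeas.aemeasurable]
      congr 1
      funext u
      congr 1
      funext ξ
      have : (Set.Iic (t + s)).indicator (1 : ℝ → ENNReal) (partialSum (m + k + 1) ξ + u) =
          (Set.Iic (t + (s - u))).indicator 1 (partialSum (m + k + 1) ξ) := by
        simp only [Set.indicator, Set.mem_Iic, ← add_sub_assoc, le_sub_iff_add_le]
        rfl
      rw [this]
      ring
    rw [hsw]
    simp_rw [ih]
    rw [lintegral_const_mul _ (by fun_prop), mul_left_comm, lintegral_Ioi_pow_max hlam]

/-- The gap after the last arrival S must reach beyond t + s. Its tail e^{λS} e^{-λ(t+s)} supplies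
the weight required by `lintegral_past_mul_arrivals`. -/
theorem lintegral_past_mul_increment_aux (hlam : 0 < lam) {m : ℕ} {t : ℝ} {W : (ℤ → ℝ) → ENNReal}
    (hW : Measurable W) (hWu : ∀ ξ (j : ℤ) u, m < j → W (Function.update ξ j u) = W ξ)
    (hW0 : ∀ ξ, t < partialSum m ξ → W ξ = 0) (k : ℕ) {s : ℝ} (hs : 0 ≤ s) :
    ∫⁻ ξ, W ξ * (Set.Ioi t).indicator 1 (partialSum (m + 1) ξ) *
        (Set.Iic (t + s)).indicator 1 (partialSum (m + k) ξ) *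
        (Set.Ioi (t + s)).indicator 1 (partialSum (m + k + 1) ξ) ∂gapLaw lam =
      (∫⁻ ξ, W ξ * ENNReal.ofReal (Real.exp (lam * partialSum m ξ)) ∂gapLaw lam) *
        ENNReal.ofReal (Real.exp (-(lam * (t + s)))) *
        ENNReal.ofReal ((lam * s) ^ k / k.factorial) := by
  have hH : Measurable ((Set.Ioi (t + s)).indicator (1 : ℝ → ENNReal)) :=
    measurable_one.indicator measurableSet_Ioi
  have hsurv (x : ℝ) (hx : x ≤ t + s) :
      ∫⁻ u, (Set.Ioi (t + s)).indicator 1 (x + u) ∂expMeasure lam =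
        ENNReal.ofReal (Real.exp (lam * x)) * ENNReal.ofReal (Real.exp (-(lam * (t + s)))) := by
    have : (fun u => (Set.Ioi (t + s)).indicator (1 : ℝ → ENNReal) (x + u)) =
        (Set.Ioi (t + s - x)).indicator 1 := by
      funext u
      simp only [Set.indicator, Set.mem_Ioi, sub_lt_iff_lt_add']
      rfl
    rw [this, lintegral_indicator_one measurableSet_Ioi, expMeasure_Ioi hlam (by linarith),
      ← ENNReal.ofReal_mul (Real.exp_pos _).le, ← Real.exp_add]
    congr 2
    ring
  cases k with
  | zero =>
    have h : ∀ ξ, W ξ * (Set.Ioi t).indicator 1 (partialSum (m + 1) ξ) *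
        (Set.Iic (t + s)).indicator 1 (partialSum (m + 0) ξ) *
        (Set.Ioi (t + s)).indicator 1 (partialSum (m + 0 + 1) ξ) =
        W ξ * (Set.Ioi (t + s)).indicator 1 (partialSum (m + 1) ξ) := by
      intro ξ
      rw [add_zero]
      rcases le_or_gt (partialSum m ξ) t with hle | hlt
      · by_cases h1 : t + s < partialSum (m + 1) ξ
        · have h2 : t < partialSum (m + 1) ξ := by linarith
          have h3 : partialSum m ξ ≤ t + s := by linarith
          simp [Set.indicator, h1, h2, h3]
        · simp [Set.indicator, h1]
      · simp [hW0 ξ hlt]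
    simp_rw [h]
    rw [lintegral_mul_comp_partialSum_succ hlam m hW (fun ξ u => hWu ξ _ u (by omega)) hH]
    simp only [pow_zero, Nat.factorial_zero, Nat.cast_one, div_one, ENNReal.ofReal_one, mul_one]
    rw [← lintegral_mul_const' _ _ ENNReal.ofReal_ne_top]
    congr 1
    funext ξ
    rcases le_or_gt (partialSum m ξ) t with hle | hlt
    · rw [hsurv _ (by linarith), mul_assoc]
    · simp [hW0 ξ hlt]
  | succ k =>
    have hV : Measurable fun ξ => W ξ * (Set.Ioi t).indicator 1 (partialSum (m + 1) ξ) *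
        (Set.Iic (t + s)).indicator 1 (partialSum (m + (k + 1)) ξ) :=
      (hW.mul ((measurable_one.indicator measurableSet_Ioi).comp (measurable_partialSum _))).mul
        ((measurable_one.indicator measurableSet_Iic).comp (measurable_partialSum _))
    rw [lintegral_mul_comp_partialSum_succ hlam (m + (k + 1)) hV (fun ξ u => by
      rw [hWu ξ _ u (by push_cast; omega), partialSum_update _ _ _ _ (by push_cast; omega),
        partialSum_update _ _ _ _ (by push_cast; omega)]) hH]
    have key := lintegral_past_mul_arrivals hlam hW hWu hW0 k s
    rw [max_eq_left hs] at key
    rw [mul_right_comm, ← key, ← lintegral_mul_const' _ _ ENNReal.ofReal_ne_top]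
    congr 1
    funext ξ
    rw [← add_assoc]
    by_cases hle : partialSum (m + k + 1) ξ ≤ t + s
    · rw [hsurv _ hle]
      ring
    · simp [Set.indicator, hle]

/-- The number of arrivals in `(t, t + s]` is Poisson and independent of the past up to `t`. -/
theorem lintegral_past_mul_increment (hlam : 0 < lam) {m : ℕ} {t : ℝ} {W : (ℤ → ℝ) → ENNReal}
    (hW : Measurable W) (hWu : ∀ ξ (j : ℤ) u, m < j → W (Function.update ξ j u) = W ξ)
    (hW0 : ∀ ξ, t < partialSum m ξ → W ξ = 0) (k : ℕ) {s : ℝ} (hs : 0 ≤ s) :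
    ∫⁻ ξ, W ξ * (Set.Ioi t).indicator 1 (partialSum (m + 1) ξ) *
        (Set.Iic (t + s)).indicator 1 (partialSum (m + k) ξ) *
        (Set.Ioi (t + s)).indicator 1 (partialSum (m + k + 1) ξ) ∂gapLaw lam =
      (∫⁻ ξ, W ξ * (Set.Ioi t).indicator 1 (partialSum (m + 1) ξ) ∂gapLaw lam) *
        ENNReal.ofReal (Real.exp (-(lam * s)) * ((lam * s) ^ k / k.factorial)) := by
  -- The case k = 0, s = 0 evaluates the past event itself and so eliminates the weighted integral
  -- of W; the quotient of the exponentials is e^{-λs}.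
  have h0 := lintegral_past_mul_increment_aux hlam hW hWu hW0 0 le_rfl
  have h1 : ∀ ξ, W ξ * (Set.Ioi t).indicator 1 (partialSum (m + 1) ξ) *
        (Set.Iic (t + 0)).indicator 1 (partialSum (m + 0) ξ) *
        (Set.Ioi (t + 0)).indicator 1 (partialSum (m + 0 + 1) ξ) =
        W ξ * (Set.Ioi t).indicator 1 (partialSum (m + 1) ξ) := by
    intro ξ
    rw [add_zero, add_zero]
    rcases le_or_gt (partialSum m ξ) t with hle | hlt
    · by_cases h1 : t < partialSum (m + 1) ξ <;> simp [Set.indicator, h1, hle]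
    · simp [hW0 ξ hlt]
  simp_rw [h1] at h0
  rw [lintegral_past_mul_increment_aux hlam hW hWu hW0 k hs, h0]
  simp only [pow_zero, Nat.factorial_zero, Nat.cast_one, div_one, ENNReal.ofReal_one, mul_one,
    add_zero]
  rw [ENNReal.ofReal_mul (Real.exp_pos _).le, mul_add, neg_add, Real.exp_add,
    ENNReal.ofReal_mul (Real.exp_pos _).le]
  ring

/-- Given the arrival times up to `t`, the number of arrivals in `(t, t + s]` is Poisson. -/
theorem poissonLaw_past_inter_increment (hlam : 0 < lam) (m k : ℕ) (t s : ℝ≥0)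
    {B : Set (Finset.Icc (1 : ℤ) m → EReal)} (hB : MeasurableSet B) :
    poissonLaw lam ({τ | (fun n : Finset.Icc (1 : ℤ) m => τ.1 n) ∈ B} ∩
        {τ | τ.index t = m} ∩ {τ | τ.index (t + s) = m + k}) =
      poissonLaw lam ({τ | (fun n : Finset.Icc (1 : ℤ) m => τ.1 n) ∈ B} ∩ {τ | τ.index t = m}) *
        ENNReal.ofReal (Real.exp (-(lam * s)) * ((lam * s) ^ k / k.factorial)) := by
  classical
  have := isProbabilityMeasure_expMeasure hlam
  have hpre : Measurable fun x : ℤ → EReal => fun n : Finset.Icc (1 : ℤ) m => x n :=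
    measurable_pi_lambda _ fun n => measurable_pi_apply _
  let lvl (r : ℝ) (n : ℤ) : Set (ℤ → EReal) :=
    {x | x n ≤ (r : EReal)} ∩ {x | (r : EReal) < x (n + 1)}
  have hlvl (r : ℝ) (n : ℤ) : MeasurableSet (lvl r n) :=
    (measurableSet_le (measurable_pi_apply _) measurable_const).inter
      (measurableSet_lt measurable_const (measurable_pi_apply _))
  have hidx (r : ℝ) (n : ℤ) : {τ : TimeSeq | τ.index r = n} = Subtype.val ⁻¹' lvl r n := by
    ext τ
    exact TimeSeq.index_eq_iff τ r n
  have hBp : {τ : TimeSeq | (fun n : Finset.Icc (1 : ℤ) m => τ.1 n) ∈ B} =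
      Subtype.val ⁻¹' {x : ℤ → EReal | (fun n : Finset.Icc (1 : ℤ) m => x n) ∈ B} := rfl
  have hBm : MeasurableSet {x : ℤ → EReal | (fun n : Finset.Icc (1 : ℤ) m => x n) ∈ B} := hpre hB
  -- The second condition makes the indicator vanish when arrival m is after t.
  let D : Set (ℤ → ℝ) := {ξ | (fun n : Finset.Icc (1 : ℤ) m => arrivalTimes ξ n) ∈ B} ∩
    {ξ | partialSum m ξ ≤ t}
  have hD : MeasurableSet D := ((hpre.comp measurable_arrivalTimes) hB).inter
    (measurableSet_le (measurable_partialSum m) measurable_const)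
  have hW : Measurable (D.indicator (1 : (ℤ → ℝ) → ENNReal)) := measurable_one.indicator hD
  have hWu (ξ : ℤ → ℝ) (j : ℤ) (u : ℝ) (hj : m < j) :
      D.indicator (1 : (ℤ → ℝ) → ENNReal) (Function.update ξ j u) = D.indicator 1 ξ := by
    have : Function.update ξ j u ∈ D ↔ ξ ∈ D := by
      simp only [D, Set.mem_inter_iff, Set.mem_ofPred_eq, partialSum_update m ξ j u hj]
      have : (fun n : Finset.Icc (1 : ℤ) m => arrivalTimes (Function.update ξ j u) n) =
          fun n : Finset.Icc (1 : ℤ) m => arrivalTimes ξ n := by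
        funext ⟨n, hn⟩
        rw [Finset.mem_Icc] at hn
        obtain ⟨i, rfl⟩ : ∃ i : ℕ, n = i + 1 := ⟨(n - 1).toNat, by omega⟩
        simp only [arrivalTimes_succ]
        rw [partialSum_update _ _ _ _ (by push_cast; omega)]
      rw [this]
    by_cases h : ξ ∈ D
    · rw [Set.indicator_of_mem h, Set.indicator_of_mem (this.2 h)]
      rfl
    · rw [Set.indicator_of_notMem h, Set.indicator_of_notMem fun h' => h (this.1 h')]
  have hW0 (ξ : ℤ → ℝ) (h : t < partialSum m ξ) : D.indicator (1 : (ℤ → ℝ) → ENNReal) ξ = 0 :=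
    Set.indicator_of_notMem (fun hmem => absurd hmem.2 (not_le.2 h)) _
  -- For n = 0 the arrival time is -ξ 0 whereas the partial sum is 0; both are at most r, by
  -- positivity of the gap and r ≥ 0.
  have hev : ∀ᵐ ξ ∂gapLaw lam, ∀ (r : ℝ) (n : ℕ), 0 ≤ r →
      (arrivalTimes ξ ∈ lvl r n ↔ partialSum n ξ ≤ r ∧ r < partialSum (n + 1) ξ) := by
    filter_upwards [ae_gap_pos hlam] with ξ hξ r n hr
    have h2 : (r : EReal) < arrivalTimes ξ (n + 1) ↔ r < partialSum (n + 1) ξ := by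
      rw [arrivalTimes_succ, EReal.coe_lt_coe_iff]
    have h1 : arrivalTimes ξ n ≤ (r : EReal) ↔ partialSum n ξ ≤ r := by
      cases n with
      | zero =>
        have := arrivalTimes_neg ξ 0
        simp only [Nat.cast_zero, neg_zero, zero_add, Finset.range_one,
          Finset.sum_singleton] at this
        simp only [Nat.cast_zero, this, partialSum_zero, hr, iff_true, EReal.coe_le_coe_iff]
        linarith [hξ 0]
      | succ n => rw [Nat.cast_succ, arrivalTimes_succ, EReal.coe_le_coe_iff]
    exact and_congr h1 h2
  have key := lintegral_past_mul_increment hlam hW hWu hW0 k s.2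
  rw [hidx, hidx, hBp, ← Set.preimage_inter, ← Set.preimage_inter,
    poissonLaw_preimage hlam (hBm.inter (hlvl _ _)),
    poissonLaw_preimage hlam ((hBm.inter (hlvl _ _)).inter (hlvl _ _)),
    ← lintegral_indicator_one (measurable_arrivalTimes (hBm.inter (hlvl _ _))),
    ← lintegral_indicator_one (measurable_arrivalTimes ((hBm.inter (hlvl _ _)).inter (hlvl _ _)))]
  convert key using 1
  · refine lintegral_congr_ae ?_
    filter_upwards [hev] with ξ hξ
    have e1 := hξ t m t.2
    have e2 := hξ (t + s) (m + k) (t + s).2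
    rw [Nat.cast_add] at e2
    simp only [Set.indicator, Set.mem_preimage, Set.mem_inter_iff, e1, e2, D, Set.mem_ofPred_eq,
      Set.mem_Ioi, Set.mem_Iic, Pi.one_apply, NNReal.val_eq_coe]
    by_cases a1 : (fun n : Finset.Icc (1 : ℤ) m => arrivalTimes ξ n) ∈ B <;>
      by_cases a2 : partialSum m ξ ≤ t <;> by_cases a3 : (t : ℝ) < partialSum (m + 1) ξ <;>
      by_cases a4 : partialSum (m + k) ξ ≤ t + s <;>
      by_cases a5 : (t + s : ℝ) < partialSum (m + k + 1) ξ <;> simp [a1, a2, a3, a4, a5]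
  · congr 1
    refine lintegral_congr_ae ?_
    filter_upwards [hev] with ξ hξ
    have e1 := hξ t m t.2
    simp only [Set.indicator, Set.mem_preimage, Set.mem_inter_iff, e1, D, Set.mem_ofPred_eq,
      Set.mem_Ioi, Pi.one_apply]
    by_cases a1 : (fun n : Finset.Icc (1 : ℤ) m => arrivalTimes ξ n) ∈ B <;>
      by_cases a2 : partialSum m ξ ≤ t <;> by_cases a3 : (t : ℝ) < partialSum (m + 1) ξ <;>
      simp [a1, a2, a3]

end PoissonIncrement

/-! ### Stochastic matrices, random maps and rate matrices -/

/-! ### The state as a composition of the maps on the marks. -/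

section ComposeMarks

variable {E : Type*}

/-- The composition of the maps carried by the marks `m + 1, …, m + k`. -/
def composeMarks (y : ℤ → MapMark E) (m : ℕ) : ℕ → E → E
  | 0, i => i
  | k + 1, i => (y (m + k + 1)).2 (composeMarks y m k i)

theorem composeMarks_update (y : ℤ → MapMark E) (m k : ℕ) (i : E) (n : ℤ) (u : MapMark E)
    (h : m + k < n) : composeMarks (Function.update y n u) m k i = composeMarks y m k i := by
  induction k with
  | zero => rfl
  | succ k ih =>
    rw [composeMarks, composeMarks, ih (by push_cast at h; omega),
      Function.update_of_ne (by push_cast at h; omega)]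

/-- Each mark is met in its initial state, with first component `e₀`, so only the prescribed values
of φ matter. -/
theorem coupleUpTo_add_fst {e₀ : E} {φ : Equiv.Perm (E × MapMark E)} (hφ : IsMapCoupling e₀ φ)
    {y : ℤ → MapMark E} (hy : ∀ n, (y n).1 = e₀) (m k : ℕ) (i : E) :
    (coupleUpTo φ (m + k) (i, y)).1 = composeMarks y m k (coupleUpTo φ m (i, y)).1 := by
  induction k with
  | zero => rfl
  | succ k ih =>
    rw [← add_assoc, coupleUpTo_succ, coupleAt_fst,
      coupleUpTo_snd_of_notMem φ _ _ _ (Or.inr (by omega)), ih, composeMarks]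
    have : y ((m + k : ℕ) + 1) = (e₀, (y (m + k + 1)).2) := by
      push_cast
      exact Prod.ext (hy _) rfl
    simp only
    rw [this, hφ]

theorem measurable_composeMarks [Finite E] [MeasurableSpace E]
    [DiscreteMeasurableSpace E] (m k : ℕ) (i : E) :
    Measurable fun y : ℤ → MapMark E => composeMarks y m k i := by
  induction k with
  | zero => exact measurable_const
  | succ k ih =>
    have h : Measurable fun p : MapMark E × E => p.1.2 p.2 := Measurable.of_discrete
    exact h.comp ((measurable_pi_apply _).prodMk ih)

end ComposeMarks

theorem pow_apply_nonneg {E : Type*} [Fintype E] [DecidableEq E] {P : Matrix E E ℝ}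
    (hP0 : ∀ i j, 0 ≤ P i j) (k : ℕ) (i j : E) : 0 ≤ (P ^ k) i j := by
  induction k generalizing i j with
  | zero =>
    rw [pow_zero, Matrix.one_apply]
    split_ifs <;> norm_num
  | succ k ihk =>
    rw [pow_succ, Matrix.mul_apply]
    exact Finset.sum_nonneg fun a _ => mul_nonneg (ihk _ _) (hP0 _ _)

/-! ### Random maps with independent values. -/

section RandomMaps

variable {E : Type*} [Fintype E] [DecidableEq E] {P : Matrix E E ℝ}

theorem sum_prod_pi (hP1 : ∀ i, ∑ j, P i j = 1) : ∑ β : E → E, ∏ i, P i (β i) = 1 := by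
  have h := Finset.prod_univ_sum (fun _ : E => (Finset.univ : Finset E)) (fun i j => P i j)
  rw [Fintype.piFinset_univ] at h
  rw [← h]
  simp [hP1]

/-- Expand the product of the row sums over choice functions, with the sum of row i cut down to the
entry j. -/
theorem sum_prod_pi_of_eq (hP1 : ∀ i, ∑ j, P i j = 1) (i j : E) :
    ∑ β : E → E, (if β i = j then ∏ l, P l (β l) else 0) = P i j := by
  have h := Finset.prod_univ_sum
    (fun l : E => if l = i then ({j} : Finset E) else Finset.univ) (fun i j => P i j)
  have h1 : ∏ l, ∑ a ∈ (if l = i then ({j} : Finset E) else Finset.univ), P l a = P i j := by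
    rw [Finset.prod_eq_single i]
    · simp
    · intro l _ hl
      simp [hl, hP1]
    · simp
  rw [← h1, h, ← Finset.sum_filter]
  refine Finset.sum_congr ?_ fun _ _ => rfl
  ext β
  simp only [Finset.mem_filter, Finset.mem_univ, true_and, Fintype.mem_piFinset]
  constructor
  · intro hβ l
    split_ifs with hl
    · simp [hl, hβ]
    · simp
  · intro hβ
    simpa using hβ i

variable [MeasurableSpace E] [DiscreteMeasurableSpace E]

theorem mapLaw_apply (P : Matrix E E ℝ) (S : Set (E → E)) [DecidablePred (· ∈ S)] :
    mapLaw P S = ∑ β : E → E, if β ∈ S then ENNReal.ofReal (∏ i, P i (β i)) else 0 := by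
  simp only [mapLaw, Measure.coe_finsetSum, Finset.sum_apply, Measure.smul_apply,
    Measure.dirac_apply, smul_eq_mul, Set.indicator]
  simp

theorem isProbabilityMeasure_mapLaw (hP0 : ∀ i j, 0 ≤ P i j) (hP1 : ∀ i, ∑ j, P i j = 1) :
    IsProbabilityMeasure (mapLaw P) := by
  classical
  refine ⟨?_⟩
  rw [mapLaw_apply]
  simp only [Set.mem_univ, if_true]
  rw [← ENNReal.ofReal_sum_of_nonneg fun β _ => Finset.prod_nonneg fun i _ => hP0 _ _,
    sum_prod_pi hP1, ENNReal.ofReal_one]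

theorem mapLaw_eval_eq (hP0 : ∀ i j, 0 ≤ P i j) (hP1 : ∀ i, ∑ j, P i j = 1) (i j : E) :
    mapLaw P {β | β i = j} = ENNReal.ofReal (P i j) := by
  classical
  rw [mapLaw_apply, ← sum_prod_pi_of_eq hP1 i j, ENNReal.ofReal_sum_of_nonneg]
  · refine Finset.sum_congr rfl fun β _ => ?_
    by_cases h : β i = j <;> simp [h]
  · intro β _
    split_ifs
    · exact Finset.prod_nonneg fun i _ => hP0 _ _
    · exact le_rfl

/-- The law `δ_{e₀} ⊗ p` of a single mark. -/
abbrev markLaw (e₀ : E) (P : Matrix E E ℝ) : Measure (MapMark E) :=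
  (Measure.dirac e₀).prod (mapLaw P)

theorem isProbabilityMeasure_markLaw (e₀ : E) (hP0 : ∀ i j, 0 ≤ P i j)
    (hP1 : ∀ i, ∑ j, P i j = 1) : IsProbabilityMeasure (markLaw e₀ P) := by
  have := isProbabilityMeasure_mapLaw hP0 hP1
  infer_instance

theorem lintegral_markLaw_eval (e₀ : E) (hP0 : ∀ i j, 0 ≤ P i j) (hP1 : ∀ i, ∑ j, P i j = 1)
    (i j : E) : ∫⁻ u, (if u.2 i = j then 1 else 0) ∂markLaw e₀ P = ENNReal.ofReal (P i j) := by
  have := isProbabilityMeasure_mapLaw hP0 hP1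
  have h : (fun u : MapMark E => (if u.2 i = j then 1 else 0 : ENNReal)) =
      Set.indicator (Set.univ ×ˢ {β | β i = j}) 1 := by
    funext u
    simp [Set.indicator]
  rw [h, lintegral_indicator_one (MeasurableSet.of_discrete), Measure.prod_prod,
    mapLaw_eval_eq hP0 hP1]
  simp

theorem ae_mark_fst_eq (e₀ : E) (hP0 : ∀ i j, 0 ≤ P i j) (hP1 : ∀ i, ∑ j, P i j = 1) :
    ∀ᵐ y ∂Measure.infinitePi fun _ : ℤ => markLaw e₀ P, ∀ n, (y n).1 = e₀ := by
  have := isProbabilityMeasure_markLaw e₀ hP0 hP1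
  have := isProbabilityMeasure_mapLaw hP0 hP1
  refine ae_all_iff.2 fun n => ?_
  have h : ∀ᵐ u ∂markLaw e₀ P, u.1 = e₀ := by
    have h0 : ∀ᵐ i ∂Measure.dirac e₀, i = e₀ := by simp [ae_dirac_eq]
    exact Measure.quasiMeasurePreserving_fst.ae h0
  exact (measurePreserving_eval_infinitePi
    (fun _ : ℤ => markLaw e₀ P) n).quasiMeasurePreserving.ae h

/-- The composition of `k` i.i.d. random maps moves `i` to `j` with probability `(P ^ k) i j`,
independently of the past. -/
theorem lintegral_past_mul_composeMarks (e₀ : E) (hP0 : ∀ i j, 0 ≤ P i j)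
    (hP1 : ∀ i, ∑ j, P i j = 1) {m : ℕ} {W : (ℤ → MapMark E) → ENNReal} (hW : Measurable W)
    (hWu : ∀ y (n : ℤ) u, m < n → W (Function.update y n u) = W y) (k : ℕ) (i j : E) :
    ∫⁻ y, W y * (if composeMarks y m k i = j then 1 else 0)
        ∂(Measure.infinitePi fun _ : ℤ => markLaw e₀ P) =
      (∫⁻ y, W y ∂(Measure.infinitePi fun _ : ℤ => markLaw e₀ P)) *
        ENNReal.ofReal ((P ^ k) i j) := by
  have := isProbabilityMeasure_markLaw e₀ hP0 hP1
  have hite (k : ℕ) (i j : E) : Measurable fun y : ℤ → MapMark E =>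
      (if composeMarks y m k i = j then 1 else 0 : ENNReal) :=
    Measurable.ite (measurable_composeMarks m k i (measurableSet_singleton j))
      measurable_const measurable_const
  induction k generalizing j with
  | zero =>
    by_cases h : i = j <;> simp [composeMarks, h]
  | succ k ih =>
    -- Splitting over the intermediate state l gives the last map a fixed argument. Its mark can
    -- then be integrated out alone, since W and the earlier composition ignore it.
    have hsplit (y : ℤ → MapMark E) :
        (if composeMarks y m (k + 1) i = j then 1 else 0 : ENNReal) =
        ∑ l, (if composeMarks y m k i = l then 1 else 0) *
          (if (y (m + k + 1)).2 l = j then 1 else 0) := by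
      rw [Finset.sum_eq_single (composeMarks y m k i) (fun l _ hl => by simp [hl.symm])
        (by simp), if_pos rfl, one_mul]
      rfl
    have hmark (l : E) : Measurable fun y : ℤ → MapMark E =>
        (if (y (m + k + 1)).2 l = j then 1 else 0 : ENNReal) := by
      have h : Measurable fun u : MapMark E => (if u.2 l = j then 1 else 0 : ENNReal) :=
        Measurable.of_discrete
      exact h.comp (measurable_pi_apply (X := fun _ : ℤ => MapMark E) _)
    simp_rw [hsplit, Finset.mul_sum]
    rw [lintegral_finsetSum Finset.univ (f := fun l y => W y *
      ((if composeMarks y m k i = l then 1 else 0) * (if (y (m + k + 1)).2 l = j then 1 else 0)))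
      fun l _ => hW.mul ((hite k i l).mul (hmark l))]
    have hl (l : E) : ∫⁻ y, W y * ((if composeMarks y m k i = l then 1 else 0) *
          (if (y (m + k + 1)).2 l = j then 1 else 0))
            ∂(Measure.infinitePi fun _ : ℤ => markLaw e₀ P) =
        (∫⁻ y, W y ∂(Measure.infinitePi fun _ : ℤ => markLaw e₀ P)) *
          ENNReal.ofReal ((P ^ k) i l) * ENNReal.ofReal (P l j) := by
      rw [lintegral_update_infinitePi (fun _ : ℤ => markLaw e₀ P) (m + k + 1)
        (F := fun y => W y * ((if composeMarks y m k i = l then 1 else 0) *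
          (if (y (m + k + 1)).2 l = j then 1 else 0))) (hW.mul ((hite k i l).mul (hmark l))),
        ← ih l, ← lintegral_mul_const' _ _ ENNReal.ofReal_ne_top]
      congr 1
      funext y
      have h (u : MapMark E) : W (Function.update y (m + k + 1) u) *
          ((if composeMarks (Function.update y (m + k + 1) u) m k i = l then 1 else 0) *
          (if (Function.update y ((m : ℤ) + k + 1) u (m + k + 1)).2 l = j then 1 else 0)) =
          W y * (if composeMarks y m k i = l then 1 else 0) *
            (if u.2 l = j then 1 else 0) := by
        rw [hWu y _ u (by omega), composeMarks_update _ _ _ _ _ _ (by omega),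
          Function.update_self, mul_assoc]
      simp_rw [h]
      rw [lintegral_const_mul _ Measurable.of_discrete, lintegral_markLaw_eval e₀ hP0 hP1]
    have hk0 (l : E) : 0 ≤ (P ^ k) i l := pow_apply_nonneg hP0 k i l
    simp_rw [hl, mul_assoc, ← ENNReal.ofReal_mul (hk0 _)]
    rw [← Finset.mul_sum, ← ENNReal.ofReal_sum_of_nonneg fun l _ => mul_nonneg (hk0 l) (hP0 l j),
      pow_succ, Matrix.mul_apply]

end RandomMaps

/-! ### Uniformization of a rate matrix. -/

section RateMatrices

variable {E : Type*} [Fintype E] {R : Matrix E E ℝ}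

theorem IsRateMatrix.diag_nonpos [DecidableEq E] (hR : IsRateMatrix R) (i : E) : R i i ≤ 0 := by
  have h := hR.2 i
  rw [← Finset.add_sum_erase _ _ (Finset.mem_univ i)] at h
  have : 0 ≤ ∑ j ∈ Finset.univ.erase i, R i j :=
    Finset.sum_nonneg fun j hj => hR.1 i j (Finset.ne_of_mem_erase hj).symm
  linarith

variable [Nonempty E] [DecidableEq E]

theorem neg_diag_le_jumpRate (R : Matrix E E ℝ) (i : E) :
    -R i i ≤ jumpRate R := by
  rw [jumpRate]
  split_ifs with h
  · simp [h]
  · exact Finset.le_sup' (fun i => -R i i) (Finset.mem_univ i)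

/-- If the maximal exit rate were not positive, the diagonal would vanish, and nonnegative rows with
sum zero would force R = 0. -/
theorem IsRateMatrix.jumpRate_pos (hR : IsRateMatrix R) : 0 < jumpRate R := by
  by_cases h : R = 0
  · simp [jumpRate, h]
  · by_contra hle
    have hdiag (i : E) : R i i = 0 := by
      have := neg_diag_le_jumpRate R i
      have := hR.diag_nonpos i
      linarith
    refine h (Matrix.ext fun i j => ?_)
    by_cases hij : i = j
    · rw [← hij, hdiag]
      rfl
    · have hsum := hR.2 i
      have hnn : ∀ j ∈ Finset.univ, 0 ≤ R i j := fun j _ => by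
        by_cases hij : i = j
        · rw [← hij, hdiag]
        · exact hR.1 i j hij
      exact (Finset.sum_eq_zero_iff_of_nonneg hnn).1 hsum j (Finset.mem_univ j)

theorem IsRateMatrix.jumpMatrix_nonneg (hR : IsRateMatrix R) (i j : E) :
    0 ≤ jumpMatrix R i j := by
  have hpos := hR.jumpRate_pos
  simp only [jumpMatrix, Matrix.add_apply, Matrix.smul_apply, smul_eq_mul, Matrix.one_apply]
  split_ifs with h
  · subst h
    have h1 := mul_le_mul_of_nonneg_left (neg_diag_le_jumpRate R i) (inv_nonneg.2 hpos.le)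
    rw [inv_mul_cancel₀ hpos.ne'] at h1
    linarith
  · have := mul_nonneg (inv_nonneg.2 hpos.le) (hR.1 i j h)
    linarith

theorem IsRateMatrix.sum_jumpMatrix (hR : IsRateMatrix R) (i : E) :
    ∑ j, jumpMatrix R i j = 1 := by
  simp [jumpMatrix, Finset.sum_add_distrib, ← Finset.mul_sum, hR.2 i, Matrix.one_apply]

/-- With c = λs one has sR = -c + cP. The two terms commute, so e^{sR} = e^{-c} e^{cP}, a mixture of
the powers of P with Poisson weights. -/
theorem IsRateMatrix.hasSum_exp (hR : IsRateMatrix R) (s : ℝ) (i j : E) :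
    HasSum (fun k : ℕ => Real.exp (-(jumpRate R * s)) * ((jumpRate R * s) ^ k / k.factorial) *
      (jumpMatrix R ^ k) i j) (NormedSpace.exp (s • R) i j) := by
  let := Matrix.linftyOpNormedRing (n := E) (α := ℝ)
  let := Matrix.linftyOpNormedAlgebra (n := E) (α := ℝ) (R := ℝ)
  have hpos := hR.jumpRate_pos
  set c := jumpRate R * s with hc
  have h1 : s • R = (-c) • (1 : Matrix E E ℝ) + c • jumpMatrix R := by
    rw [jumpMatrix, smul_add, smul_smul, hc, neg_smul, neg_add_cancel_left, mul_right_comm,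
      mul_inv_cancel₀ hpos.ne', one_mul]
  have hcomm : Commute ((-c) • (1 : Matrix E E ℝ)) (c • jumpMatrix R) :=
    ((Commute.one_left _).smul_left _).smul_right _
  have h2 : NormedSpace.exp ((-c) • (1 : Matrix E E ℝ)) = Real.exp (-c) • 1 := by
    have := (NormedSpace.algebraMap_exp_comm (𝕂 := ℝ) (𝔸 := Matrix E E ℝ) (-c))
    rw [Algebra.algebraMap_eq_smul_one, Algebra.algebraMap_eq_smul_one] at this
    rw [Real.exp_eq_exp_ℝ]
    exact this.symm
  rw [h1, Matrix.exp_add_of_commute _ _ hcomm, h2, smul_mul_assoc, one_mul]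
  have h3 := NormedSpace.exp_series_hasSum_exp' (𝕂 := ℝ) (c • jumpMatrix R)
  have h4 : HasSum (fun k : ℕ => ((k.factorial : ℝ)⁻¹ • (c • jumpMatrix R) ^ k) i j)
      (NormedSpace.exp (c • jumpMatrix R) i j) := Pi.hasSum.1 (Pi.hasSum.1 h3 i) j
  have h5 := h4.mul_left (Real.exp (-c))
  rw [Matrix.smul_apply, smul_eq_mul]
  refine (congrArg (fun f => HasSum f _) (funext fun k => ?_)).mpr h5
  rw [smul_pow, Matrix.smul_apply, Matrix.smul_apply, smul_eq_mul, smul_eq_mul]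
  ring

theorem IsRateMatrix.exp_nonneg (hR : IsRateMatrix R) {s : ℝ}
    (hs : 0 ≤ s) (i j : E) : 0 ≤ NormedSpace.exp (s • R) i j := by
  have hlam := hR.jumpRate_pos
  refine (hR.hasSum_exp s i j).nonneg fun k => mul_nonneg (by positivity) ?_
  exact pow_apply_nonneg hR.jumpMatrix_nonneg k i j

end RateMatrices

/-! ### The Markov property -/

/-! ### From identities on events to conditional probabilities. -/

section CondExp

theorem measure_eq_tsum_inter_fiber {Ω : Type*} [MeasurableSpace Ω] (μ : Measure Ω) {N : Ω → ℕ}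
    (hN : Measurable N) {S : Set Ω} (hS : MeasurableSet S) :
    μ S = ∑' n, μ (S ∩ N ⁻¹' {n}) := by
  rw [← measure_iUnion]
  · congr 1
    ext ω
    simp
  · intro m n hmn
    refine Set.disjoint_left.2 fun ω h1 h2 => hmn ?_
    exact h1.2.symm.trans h2.2
  · exact fun n => hS.inter (hN (measurableSet_singleton n))

/-- If `B` has conditional probability `f i` on `X = i`, then `f ∘ X` is the conditional
probability of `B`. -/
theorem condExp_indicator_of_measure_inter {Ω E : Type*} [Fintype E] [MeasurableSpace E]
    [DiscreteMeasurableSpace E] {𝒢 mΩ : MeasurableSpace Ω} (h𝒢 : 𝒢 ≤ mΩ) {μ : Measure Ω}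
    [IsProbabilityMeasure μ] {X : Ω → E} (hX : Measurable[𝒢] X) {B : Set Ω}
    (hB : MeasurableSet B) {f : E → ℝ} (hf : ∀ i, 0 ≤ f i)
    (h : ∀ A, MeasurableSet[𝒢] A → ∀ i,
      μ (A ∩ X ⁻¹' {i} ∩ B) = μ (A ∩ X ⁻¹' {i}) * ENNReal.ofReal (f i)) :
    μ[B.indicator (fun _ => (1 : ℝ)) | 𝒢] =ᵐ[μ] fun ω => f (X ω) := by
  classical
  have hX' : Measurable X := hX.mono h𝒢 le_rfl
  have hfX : Measurable[𝒢] fun ω => f (X ω) := (Measurable.of_discrete (f := f)).comp hX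
  have hXi (i : E) : MeasurableSet (X ⁻¹' {i}) := hX' (measurableSet_singleton i)
  have hsum (g : Ω → ℝ) (ω : Ω) : ∑ i, (X ⁻¹' {i}).indicator g ω = g ω := by
    simp [Set.indicator]
  have hfi : Integrable (fun ω => f (X ω)) μ :=
    Integrable.of_finite.comp_measurable hX'
  have hBi : Integrable (B.indicator fun _ => (1 : ℝ)) μ := (integrable_const 1).indicator hB
  refine (ae_eq_condExp_of_forall_setIntegral_eq h𝒢 hBi (fun s _ _ => hfi.integrableOn) ?_
    hfX.stronglyMeasurable.aestronglyMeasurable).symm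
  intro A hA _
  have hA' : MeasurableSet A := h𝒢 _ hA
  -- On each piece X = i the candidate f ∘ X is constant, so the finite decomposition reduces the
  -- claim to the hypothesis on events.
  have hdec {g : Ω → ℝ} (hg : Integrable g μ) :
      ∫ ω in A, g ω ∂μ = ∑ i, ∫ ω in A ∩ X ⁻¹' {i}, g ω ∂μ := by
    calc ∫ ω in A, g ω ∂μ = ∫ ω in A, ∑ i, (X ⁻¹' {i}).indicator g ω ∂μ := by simp_rw [hsum]
      _ = ∑ i, ∫ ω in A, (X ⁻¹' {i}).indicator g ω ∂μ :=
        integral_finsetSum _ fun i _ => (hg.indicator (hXi i)).integrableOn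
      _ = _ := Finset.sum_congr rfl fun i _ => setIntegral_indicator (hXi i)
  rw [hdec hfi, hdec hBi]
  refine Finset.sum_congr rfl fun i _ => ?_
  have h1 : ∫ ω in A ∩ X ⁻¹' {i}, f (X ω) ∂μ = ∫ ω in A ∩ X ⁻¹' {i}, f i ∂μ :=
    setIntegral_congr_fun (hA'.inter (hXi i)) fun ω hω => congrArg f hω.2
  rw [h1, setIntegral_const, setIntegral_indicator hB, setIntegral_const, measureReal_def,
    measureReal_def, h A hA i, ENNReal.toReal_mul, ENNReal.toReal_ofReal (hf i), smul_eq_mul,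
    smul_eq_mul, mul_one]

theorem dirac_prod_envLaw_apply {E G : Type*} [MeasurableSpace E]
    [MeasurableSpace G] {q : Measure G} {lam : ℝ}
    [IsProbabilityMeasure q] [IsProbabilityMeasure (poissonLaw lam)] (k : E)
    {S : Set (E × Env G)} (hS : MeasurableSet S) :
    (Measure.dirac k).prod (envLaw q lam) S =
      ∫⁻ y, poissonLaw lam {τ | (k, y, τ) ∈ S} ∂Measure.infinitePi fun _ : ℤ => q := by
  have : SFinite (envLaw q lam) := by
    unfold envLaw
    infer_instance
  rw [Measure.dirac_prod, Measure.map_apply measurable_prodMk_left hS, envLaw,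
    Measure.prod_apply (measurable_prodMk_left hS)]
  rfl

end CondExp

/-! ### The Markov property of the evolved state. -/

section Markov

variable {E : Type*} [Fintype E] [DecidableEq E] [MeasurableSpace E] [DiscreteMeasurableSpace E]

/-- The probability of a past event, `m` arrivals up to time `t`, `k` arrivals in `(t, t + s]`
and a given displacement under the last `k` maps. -/
theorem measure_past_inter_increment (e₀ : E) {P : Matrix E E ℝ} (hP0 : ∀ i j, 0 ≤ P i j)
    (hP1 : ∀ i, ∑ j, P i j = 1) {lam : ℝ} (hlam : 0 < lam) (x : E) (t s : ℝ≥0) (m k : ℕ) (i j : E)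
    {D : Set (E × (Finset.Icc (1 : ℤ) m → MapMark E) × (Finset.Icc (1 : ℤ) m → EReal))}
    (hD : MeasurableSet D) :
    (Measure.dirac x).prod (envLaw (markLaw e₀ P) lam)
        (pastData (m : ℤ) ⁻¹' D ∩ {ω | ω.2.2.index t = m} ∩ {ω | ω.2.2.index (t + s) = m + k} ∩
          {ω | composeMarks ω.2.1 m k i = j}) =
      (Measure.dirac x).prod (envLaw (markLaw e₀ P) lam)
        (pastData (m : ℤ) ⁻¹' D ∩ {ω | ω.2.2.index t = m}) *
        ENNReal.ofReal (Real.exp (-(lam * s)) * ((lam * s) ^ k / k.factorial) * (P ^ k) i j) := by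
  have := isProbabilityMeasure_markLaw e₀ hP0 hP1
  have := isProbabilityMeasure_poissonLaw hlam
  have hpast : Measurable (pastData (E := E) (G := MapMark E) (m : ℤ)) :=
    measurable_fst.prodMk ((measurable_pi_lambda _ fun n => measurable_mark _).prodMk
      (measurable_pi_lambda _ fun n => measurable_time_env _))
  have hidx (r : ℝ) (n : ℤ) : MeasurableSet {ω : E × Env (MapMark E) | ω.2.2.index r = n} :=
    measurable_index_env r (measurableSet_singleton n)
  have hcomp : MeasurableSet {ω : E × Env (MapMark E) | composeMarks ω.2.1 m k i = j} :=
    ((measurable_composeMarks m k i).comp (measurable_fst.comp measurable_snd))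
      (measurableSet_singleton j)
  have hA : MeasurableSet (pastData (m : ℤ) ⁻¹' D ∩
    {ω : E × Env (MapMark E) | ω.2.2.index t = m}) := (hpast hD).inter (hidx _ _)
  rw [dirac_prod_envLaw_apply x ((hA.inter (hidx _ _)).inter hcomp), dirac_prod_envLaw_apply x hA]
  -- The probability of the past event for frozen marks. It depends only on the marks up to m, so
  -- the next k maps are independent of it.
  set W : (ℤ → MapMark E) → ENNReal := fun y => poissonLaw lam
    {τ | (x, y, τ) ∈ pastData (m : ℤ) ⁻¹' D ∩ {ω : E × Env (MapMark E) | ω.2.2.index t = m}}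
    with hW
  have hWm : Measurable W :=
    measurable_measure_prodMk_left (ν := poissonLaw lam)
      ((measurable_prodMk_left (x := x) :
        Measurable fun p : Env (MapMark E) => (x, p)) hA)
  have hWu (y : ℤ → MapMark E) (n : ℤ) (u : MapMark E) (hn : m < n) :
      W (Function.update y n u) = W y := by
    have (τ : TimeSeq) : pastData (m : ℤ) (x, Function.update y n u, τ) =
        pastData (m : ℤ) (x, y, τ) := by
      simp only [pastData]
      refine Prod.ext rfl (Prod.ext (funext fun l => ?_) rfl)
      have := (Finset.mem_Icc.1 l.2).2
      exact Function.update_of_ne (by omega) _ _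
    simp only [hW, Set.mem_inter_iff, Set.mem_preimage, this]
    rfl
  have key := lintegral_past_mul_composeMarks e₀ hP0 hP1 hWm hWu k i j
  have hc : 0 ≤ Real.exp (-(lam * s)) * ((lam * s) ^ k / k.factorial) := by positivity
  rw [ENNReal.ofReal_mul hc, mul_comm (ENNReal.ofReal (_ * _)), ← mul_assoc, ← key,
    ← lintegral_mul_const' _ _ ENNReal.ofReal_ne_top]
  congr 1
  funext y
  -- For frozen marks the displacement is decided, and only the arrival times remain random; they
  -- contribute the Poisson factor.
  by_cases hy : composeMarks y m k i = j
  · rw [if_pos hy, mul_one]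
    have hB : MeasurableSet {v : Finset.Icc (1 : ℤ) m → EReal |
        (x, (fun n : Finset.Icc (1 : ℤ) m => y n), v) ∈ D} :=
      (measurable_prodMk_left.comp measurable_prodMk_left) hD
    have := poissonLaw_past_inter_increment hlam m k t s hB
    refine Eq.trans ?_ this
    congr 1
    ext τ
    simp only [Set.mem_inter_iff, Set.mem_ofPred_eq, Set.mem_preimage, hy, and_true]
    rfl
  · rw [if_neg hy, mul_zero, zero_mul]
    simp [hy]

/-- The Markov property on events of `ℱ_t`. -/
theorem measure_inter_evolution_fst [Nonempty E] (e₀ : E) {φ : Equiv.Perm (E × MapMark E)}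
    (hφ : IsMapCoupling e₀ φ) {R : Matrix E E ℝ} (hR : IsRateMatrix R) (x : E) (t s : ℝ≥0)
    {A : Set (E × Env (MapMark E))} (hA : MeasurableSet[markFiltration E (MapMark E) t] A)
    (i j : E) :
    (Measure.dirac x).prod (rateEnvLaw e₀ R)
        (A ∩ {ω | (evolution φ t ω).1 = i} ∩ {ω | (evolution φ (t + s) ω).1 = j}) =
      (Measure.dirac x).prod (rateEnvLaw e₀ R) (A ∩ {ω | (evolution φ t ω).1 = i}) *
        ENNReal.ofReal (NormedSpace.exp ((s : ℝ) • R) i j) := by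
  have hP0 := hR.jumpMatrix_nonneg
  have hP1 := hR.sum_jumpMatrix
  have hlam := hR.jumpRate_pos
  have := isProbabilityMeasure_markLaw e₀ hP0 hP1
  have := isProbabilityMeasure_poissonLaw hlam
  have : Nonempty (MapMark E) := ⟨(e₀, id)⟩
  set μ := (Measure.dirac x).prod (rateEnvLaw e₀ R) with hμ
  have hAi : MeasurableSet[markFiltration E (MapMark E) t]
      (A ∩ {ω | (evolution φ t ω).1 = i}) :=
    hA.inter (measurable_evolution_fst_markFiltration φ Measurable.of_discrete t
      (measurableSet_singleton i))
  set A' := A ∩ {ω | (evolution φ t ω).1 = i} with hA'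
  have hA'm : MeasurableSet A' := markFiltration_le t _ hAi
  have hXm (r : ℝ) : Measurable fun ω : E × Env (MapMark E) => (evolution φ r ω).1 :=
    (measurable_evolution φ Measurable.of_discrete Measurable.of_discrete r).fst
  have hBm : MeasurableSet {ω : E × Env (MapMark E) | (evolution φ (t + s) ω).1 = j} :=
    hXm _ (measurableSet_singleton j)
  let N (ω : E × Env (MapMark E)) : ℕ := (ω.2.2.index t).toNat
  let K (ω : E × Env (MapMark E)) : ℕ := (ω.2.2.index (t + s) - ω.2.2.index t).toNat
  have hN : Measurable N := (Measurable.of_discrete (f := Int.toNat)).comp (measurable_index_env _)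
  have hK : Measurable K := (Measurable.of_discrete (f := Int.toNat)).comp
    ((measurable_index_env _).sub (measurable_index_env _))
  have hNm (m : ℕ) : N ⁻¹' {m} = {ω | ω.2.2.index t = (m : ℤ)} := by
    ext ω
    have := ω.2.2.index_nonneg t
    simp only [N, Set.mem_preimage, Set.mem_singleton_iff, Set.mem_ofPred_eq]
    omega
  have hNK (m k : ℕ) : N ⁻¹' {m} ∩ K ⁻¹' {k} =
      {ω | ω.2.2.index t = (m : ℤ)} ∩ {ω | ω.2.2.index (t + s) = (m + k : ℤ)} := by
    ext ω
    have := ω.2.2.index_nonneg t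
    have := ω.2.2.index_mono (show (t : ℝ) ≤ t + s by simp)
    simp only [N, K, Set.mem_inter_iff, Set.mem_preimage, Set.mem_singleton_iff, Set.mem_ofPred_eq]
    omega
  have hmarks : ∀ᵐ ω ∂μ, ∀ n, (ω.2.1 n).1 = e₀ := by
    have h1 : ∀ᵐ ζ ∂rateEnvLaw e₀ R, ∀ n, (ζ.1 n).1 = e₀ :=
      Measure.quasiMeasurePreserving_fst.ae (ae_mark_fst_eq e₀ hP0 hP1)
    have : SFinite (rateEnvLaw e₀ R) := by
      unfold rateEnvLaw envLaw
      infer_instance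
    exact Measure.quasiMeasurePreserving_snd.ae h1
  -- Fixing the number m of arrivals up to t and k of arrivals in (t, t + s] makes the past event a
  -- condition on finitely many data and the displacement a composition of k maps.
  have hterm (m k : ℕ) :
      μ (A' ∩ {ω | (evolution φ (t + s) ω).1 = j} ∩ N ⁻¹' {m} ∩ K ⁻¹' {k}) =
        μ (A' ∩ N ⁻¹' {m}) * ENNReal.ofReal (Real.exp (-(jumpRate R * s)) *
          ((jumpRate R * s) ^ k / k.factorial) * (jumpMatrix R ^ k) i j) := by
    obtain ⟨D, hD, hDA⟩ := exists_pastData_of_measurableSet hAi (m : ℤ)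
    rw [Set.inter_assoc _ (N ⁻¹' {m}), hNK, hNm, ← Set.inter_assoc, Set.inter_right_comm A', hDA,
      Set.inter_right_comm _ {ω | (evolution φ (t + s) ω).1 = j}]
    -- The two events agree almost surely: when all marks carry `e₀`, the state at t + s is the
    -- composition of the next k maps applied to i.
    refine Eq.trans ?_ (measure_past_inter_increment e₀ hP0 hP1 hlam x t s m k i j hD)
    refine measure_congr (eventuallyEq_set.2 ?_)
    filter_upwards [hmarks] with ω hω
    refine and_congr_right fun h => ?_
    have h1 : ω.2.2.index t = m := h.1.2
    have h2 : ω.2.2.index (t + s) = m + k := h.2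
    have h3 : ω ∈ A' := by
      have : ω ∈ A' ∩ {ω | ω.2.2.index t = m} := by
        rw [hDA]
        exact h.1
      exact this.1
    have h4 : (evolution φ t ω).1 = i := h3.2
    have h5 := evolution_fst φ (t + s) ω
    rw [evolution_fst, h1, Int.toNat_natCast] at h4
    rw [NNReal.coe_add, h2, ← Nat.cast_add, Int.toNat_natCast, coupleUpTo_add_fst hφ hω, h4] at h5
    rw [Set.mem_ofPred_eq, Set.mem_ofPred_eq, h5]
  have hexp := hR.hasSum_exp (s : ℝ) i j
  have hnn (k : ℕ) : 0 ≤ Real.exp (-(jumpRate R * s)) *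
      ((jumpRate R * s) ^ k / k.factorial) * (jumpMatrix R ^ k) i j :=
    mul_nonneg (by positivity) (pow_apply_nonneg hP0 k i j)
  rw [measure_eq_tsum_inter_fiber μ hN (hA'm.inter hBm), measure_eq_tsum_inter_fiber μ hN hA'm,
    ← ENNReal.tsum_mul_right]
  refine tsum_congr fun m => ?_
  rw [measure_eq_tsum_inter_fiber μ hK
    ((hA'm.inter hBm).inter (hN (measurableSet_singleton m)))]
  simp_rw [hterm]
  -- The sum over k is the uniformized exponential series, whatever m is.
  rw [ENNReal.tsum_mul_left, ← ENNReal.ofReal_tsum_of_nonneg hnn hexp.summable, hexp.tsum_eq]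

theorem isProbabilityMeasure_rateEnvLaw [Nonempty E] (e₀ : E) {R : Matrix E E ℝ}
    (hR : IsRateMatrix R) : IsProbabilityMeasure (rateEnvLaw e₀ R) := by
  have := isProbabilityMeasure_markLaw e₀ hR.jumpMatrix_nonneg hR.sum_jumpMatrix
  have := isProbabilityMeasure_poissonLaw hR.jumpRate_pos
  unfold rateEnvLaw envLaw
  infer_instance

theorem isMarkovChain_evolution [Nonempty E] {e₀ : E} {φ : Equiv.Perm (E × MapMark E)}
    (hφ : IsMapCoupling e₀ φ) {R : Matrix E E ℝ} (hR : IsRateMatrix R) :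
    IsMarkovChain R (markFiltration E (MapMark E)) (fun t ω => (evolution φ t ω).1)
      (fun k => (Measure.dirac k).prod (rateEnvLaw e₀ R)) := by
  have := isProbabilityMeasure_rateEnvLaw e₀ hR
  have : Nonempty (MapMark E) := ⟨(e₀, id)⟩
  have hX (t : ℝ≥0) : Measurable[markFiltration E (MapMark E) t]
      fun ω : E × Env (MapMark E) => (evolution φ t ω).1 :=
    measurable_evolution_fst_markFiltration φ Measurable.of_discrete t
  have hle (t : ℝ≥0) := markFiltration_le (E := E) (G := MapMark E) t
  refine ⟨markFiltration_mono, hle, hX, fun k => inferInstance, fun k => ?_, fun k j t s => ?_,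
    fun k j t s => ?_⟩
  · simp only [NNReal.coe_zero, evolution_zero, id]
    exact Measure.map_fst_prod.trans (by simp)
  · refine condExp_indicator_of_measure_inter (hle t) (hX t)
      (f := fun i => NormedSpace.exp ((s : ℝ) • R) i j)
      ((hX (t + s)).mono (hle _) le_rfl (measurableSet_singleton j))
      (fun i => hR.exp_nonneg s.2 i j) fun A hA i => ?_
    have := measure_inter_evolution_fst e₀ hφ hR k t s hA i j
    rw [← NNReal.coe_add] at this
    exact this
  -- Events of σ(X_t) belong to ℱ_t, so the same identity on events applies.
  · have hXt := (hX t).comap_le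
    refine condExp_indicator_of_measure_inter (hXt.trans (hle t)) (comap_measurable _)
      (f := fun i => NormedSpace.exp ((s : ℝ) • R) i j)
      ((hX (t + s)).mono (hle _) le_rfl (measurableSet_singleton j))
      (fun i => hR.exp_nonneg s.2 i j) fun A hA i => ?_
    have := measure_inter_evolution_fst e₀ hφ hR k t s (hXt _ hA) i j
    rw [← NNReal.coe_add] at this
    exact this

end Markov

/-! ### The universal dilation -/

/-- The prescribed partial map is injective, because its value (β i, (i, β)) shows both i and β. On
a finite set it extends to a permutation. -/
theorem exists_isMapCoupling {E : Type*} [Finite E] (e₀ : E) :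
    ∃ φ : Equiv.Perm (E × MapMark E), IsMapCoupling e₀ φ := by
  classical
  have := Fintype.ofFinite E
  let f (x : {x : E × MapMark E // x.2.1 = e₀}) : E × MapMark E :=
    (x.1.2.2 x.1.1, (x.1.1, x.1.2.2))
  have hf : Function.Injective f := by
    rintro ⟨⟨i, a, β⟩, ha⟩ ⟨⟨i', a', β'⟩, ha'⟩ h
    simp only [f, Prod.mk.injEq] at h ha ha'
    simp [h.2.1, h.2.2, ha, ha']
  let e : {x : E × MapMark E // x.2.1 = e₀} ≃ {x // x ∈ Set.range f} := Equiv.ofInjective f hf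
  exact ⟨e.extendSubtype, fun i β => e.extendSubtype_apply_of_mem (i, (e₀, β)) rfl⟩

theorem isDilation_evolution {E : Type*} [Fintype E] [Nonempty E] [DecidableEq E]
    [MeasurableSpace E] [DiscreteMeasurableSpace E] {e₀ : E} {φ : Equiv.Perm (E × MapMark E)}
    (hφ : IsMapCoupling e₀ φ) {R : Matrix E E ℝ} (hR : IsRateMatrix R) :
    IsDilation R (markFiltration E (MapMark E)) (fun t : ℝ≥0 => evolution φ t) (evolution φ)
      (rateEnvLaw e₀ R) (fun k => (Measure.dirac k).prod (rateEnvLaw e₀ R)) where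
  measurable t := measurable_evolution φ Measurable.of_discrete Measurable.of_discrete t
  markovChain := isMarkovChain_evolution hφ hR
  isProbabilityMeasure := isProbabilityMeasure_rateEnvLaw e₀ hR
  initial k := by simp [evolution_zero]
  evolution_zero := evolution_zero φ
  evolution_add := evolution_add φ
  evolution_measurable := measurable_evolution φ Measurable.of_discrete Measurable.of_discrete
  evolves t ω := by simp [evolution_zero]

end

theorem theorem1 {E : Type*} [Fintype E] [Nonempty E] [DecidableEq E] [MeasurableSpace E]
    [DiscreteMeasurableSpace E] (e₀ : E) :
    (∃ φ : Equiv.Perm (E × MapMark E), IsMapCoupling e₀ φ) ∧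
    ∀ φ : Equiv.Perm (E × MapMark E), IsMapCoupling e₀ φ →
      IsPoissonUniversalDilation φ (fun R : RateMatrix E => rateEnvLaw e₀ R.1) := by
  refine ⟨exists_isMapCoupling e₀, fun φ hφ => ⟨fun R => isDilation_evolution hφ R.2, fun R => ?_⟩⟩
  exact
    { mark_finite := inferInstance
      law := ⟨_, _, isProbabilityMeasure_markLaw e₀ R.2.jumpMatrix_nonneg R.2.sum_jumpMatrix,
        R.2.jumpRate_pos, rfl⟩
      shift_add := shift_add
      cocycle_measurable := fun t => ⟨measurable_cocycle φ Measurable.of_discrete t,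
        measurable_cocycle_symm φ Measurable.of_discrete t⟩
      cocycle_add := cocycle_add φ
      dilation := isDilation_evolution hφ R.2 }
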